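/- **Notation.** Let $d\ge 0$ be an integer. Points of $\mathbf R^{2d}\simeq\mathbf R^d\times\mathbf R^d$ are written $X=(x,\xi)$. For $\alpha\in\mathbf N^d$ let $$h_\alpha(x)=\pi^{-\frac d4}(-1)^{|\alpha|}(2^{|\alpha|}\alpha!)^{-\frac12}e^{\frac{|x|^2}2}\,\partial^\alpha e^{-|x|^2},\qquad x\in\mathbf R^d,$$ be the Hermite function of order $\alpha$, and for $\alpha=(\alpha_1,\alpha_2)\in\mathbf N^d\times\mathbf N^d$ let $$\varrho_\alpha(x,\xi)=(2\pi)^{-\frac d2}\int_{\mathbf R^d}h_{\alpha_1}\Big(\frac y2-x\Big)\overline{h_{\alpha_2}\Big(\frac y2+x\Big)}\,e^{i\langle y,\xi\rangle}\,dy$$ be the Hermite-Wong function of order $\alpha$ on $\mathbf R^{2d}$. For $s\ge 0$ the twisted Pilipović spaces are defined as follows. * For $s>0$, $\boldsymbol{\mathcal S}_{\sigma,s}(\mathbf R^{2d})$ (respectively $\boldsymbol\Sigma_{\sigma,s}(\mathbf R^{2d})$) is the set of all $a=\sum_{\alpha\in\mathbf N^{2d}}c_\alpha\varrho_\alpha$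 with complex coefficients such that, for some $r>0$ (respectively for every $r>0$), there is a constant $C$ with $|c_\alpha|\le C e^{-r|\alpha|^{1/(2s)}}$ for all $\alpha$. * $\boldsymbol{\mathcal S}_{\sigma,0}(\mathbf R^{2d})$ is the set of all such sums with only finitely many $c_\alpha\neq 0$, and $\boldsymbol\Sigma_{\sigma,0}(\mathbf R^{2d})=\{0\}$. Under these conditions the series converges absolutely at every point, and $a$ is identified with its sum. With $D=-i\partial$, let $$H_\sigma=|X|^2-\tfrac14\Delta_X+\langle\xi,D_x\rangle-\langle x,D_\xi\rangle,\qquad \bar H_\sigma=|X|^2-\tfrac14\Delta_X-\langle\xi,D_x\rangle+\langle x,D_\xi\rangle,\qquad T_\sigma=H_\sigma\circ\bar H_\sigma .$$ **Corollary 2.6.** Let $s\ge 0$. 1. If $a\in\boldsymbol{\mathcal S}_{\sigma,s}(\mathbf R^{2d})$, then $a\in C^\infty(\mathbf R^{2d})$, and there are constants $h>0$ and $C$ such that $$\|T_\sigma^Na\|_{L^\infty}\le C\,h^{2N}(N!)^{4s}\qquad\text{for every integer }N\ge 0.$$ 2. If $a\in\boldsymbol\Sigma_{\sigma,s}(\mathbf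 R^{2d})$, then $a\in C^\infty(\mathbf R^{2d})$, and for every $h>0$ there is a constant $C$ such that $$\|T_\sigma^Na\|_{L^\infty}\le C\,h^{2N}(N!)^{4s}\qquad\text{for every integer }N\ge 0.$$ -/

import Mathlib

noncomputable section

namespace TwistedPilipovic

/-- Configuration space `ℝ^d` with its Euclidean norm. -/
abbrev Conf (d : ℕ) : Type := EuclideanSpace ℝ (Fin d)

/-- Phase space `ℝ^{2d} ≃ ℝ^d × ℝ^d`, with points `X = (x, ξ)`. The norm of this product is not
the Euclidean one, but it is only used to speak of derivatives; `|X|²` is written out as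
`|x|² + |ξ|²` where it occurs. -/
abbrev Phase (d : ℕ) : Type := Conf d × Conf d

/-- Multi-indices in `ℕ^d`. -/
abbrev MultiIdx (d : ℕ) : Type := Fin d → ℕ

/-- The length `|α| = α_1 + ⋯ + α_d`. -/
def len {d : ℕ} (α : MultiIdx d) : ℕ := ∑ j, α j

/-- The `j`-th standard basis vector of `ℝ^d`. -/
def e {d : ℕ} (j : Fin d) : Conf d := EuclideanSpace.single j 1

/-- The derivative of `f` in the direction `v`. -/
def dirDeriv {E F : Type*} [NormedAddCommGroup E] [NormedSpace ℝ E]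
    [NormedAddCommGroup F] [NormedSpace ℝ F] (v : E) (f : E → F) : E → F :=
  fun x => fderiv ℝ f x v

/-- The partial derivative `∂^α f = ∂_1^{α_1} ⋯ ∂_d^{α_d} f` of a function on `ℝ^d`. -/
def multiDeriv {d : ℕ} (α : MultiIdx d) (f : Conf d → ℝ) : Conf d → ℝ :=
  (List.finRange d).foldr (fun j g => (dirDeriv (e j))^[α j] g) f

/-- The Hermite function
`h_α(x) = π^{-d/4} (-1)^{|α|} (2^{|α|} α!)^{-1/2} e^{|x|²/2} ∂^α e^{-|x|²}` on `ℝ^d`. -/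
def hermiteFun {d : ℕ} (α : MultiIdx d) (x : Conf d) : ℝ :=
  Real.pi ^ (-(d : ℝ) / 4) * (-1) ^ len α
    * ((2 : ℝ) ^ len α * ∏ j, ((α j).factorial : ℝ)) ^ (-(1 : ℝ) / 2)
    * Real.exp (‖x‖ ^ 2 / 2) * multiDeriv α (fun y => Real.exp (-‖y‖ ^ 2)) x

/-- The Hermite-Wong function `ϱ_{α₁,α₂}` on `ℝ^{2d}`,
`ϱ_{α₁,α₂}(x, ξ) = (2π)^{-d/2} ∫ h_{α₁}(y/2 - x) h_{α₂}(y/2 + x) e^{i⟨y,ξ⟩} dy`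
(Hermite functions are real-valued, so `h_{α₂}` is its own complex conjugate). -/
def hermiteWong {d : ℕ} (α : MultiIdx d × MultiIdx d) (X : Phase d) : ℂ :=
  (((2 * Real.pi) ^ (-(d : ℝ) / 2) : ℝ) : ℂ) *
    ∫ y : Conf d,
      (hermiteFun α.1 ((2 : ℝ)⁻¹ • y - X.1) : ℂ) * (hermiteFun α.2 ((2 : ℝ)⁻¹ • y + X.1) : ℂ)
        * Complex.exp (Complex.I * ((inner ℝ y X.2 : ℝ) : ℂ))

/-- The coefficient condition of Roumieu type of order `s ≥ 0`: if `s > 0`, then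
`|c_α| ≲ exp (-r |α|^{1/(2s)})` for some `r > 0`; if `s = 0`, then all but finitely many
coefficients vanish. -/
def RoumieuCoeff {d : ℕ} (s : ℝ) (c : MultiIdx d × MultiIdx d → ℂ) : Prop :=
  if s = 0 then (Function.support c).Finite
  else ∃ r : ℝ, 0 < r ∧ ∃ C : ℝ, ∀ α,
    ‖c α‖ ≤ C * Real.exp (-r * ((len α.1 + len α.2 : ℕ) : ℝ) ^ (1 / (2 * s)))

/-- The coefficient condition of Beurling type of order `s ≥ 0`: if `s > 0`, then
`|c_α| ≲ exp (-r |α|^{1/(2s)})` for every `r > 0`; if `s = 0`, then all coefficients vanish. -/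
def BeurlingCoeff {d : ℕ} (s : ℝ) (c : MultiIdx d × MultiIdx d → ℂ) : Prop :=
  if s = 0 then c = 0
  else ∀ r : ℝ, 0 < r → ∃ C : ℝ, ∀ α,
    ‖c α‖ ≤ C * Real.exp (-r * ((len α.1 + len α.2 : ℕ) : ℝ) ^ (1 / (2 * s)))

/-- The twisted Pilipović space of Roumieu type of order `s` on `ℝ^{2d}`: the functions
`a = ∑_α c_α ϱ_α` with coefficients of Roumieu type. (Under the coefficient condition the
series converges absolutely at every point.) -/
def twistedRoumieu (d : ℕ) (s : ℝ) : Set (Phase d → ℂ) :=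
  {a | ∃ c : MultiIdx d × MultiIdx d → ℂ, RoumieuCoeff s c ∧
    ∀ X, HasSum (fun α => c α * hermiteWong α X) (a X)}

/-- The twisted Pilipović space of Beurling type of order `s` on `ℝ^{2d}`: the functions
`a = ∑_α c_α ϱ_α` with coefficients of Beurling type. -/
def twistedBeurling (d : ℕ) (s : ℝ) : Set (Phase d → ℂ) :=
  {a | ∃ c : MultiIdx d × MultiIdx d → ℂ, BeurlingCoeff s c ∧
    ∀ X, HasSum (fun α => c α * hermiteWong α X) (a X)}

/-- The partial derivative `∂_{x_j}` on phase space. -/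
def dX {d : ℕ} (j : Fin d) (f : Phase d → ℂ) : Phase d → ℂ := dirDeriv (e j, 0) f

/-- The partial derivative `∂_{ξ_j}` on phase space. -/
def dXi {d : ℕ} (j : Fin d) (f : Phase d → ℂ) : Phase d → ℂ := dirDeriv (0, e j) f

/-- The Laplacian `Δ_X = ∑_j (∂_{x_j}² + ∂_{ξ_j}²)` on phase space. -/
def laplX {d : ℕ} (f : Phase d → ℂ) (X : Phase d) : ℂ :=
  ∑ j, (dX j (dX j f) X + dXi j (dXi j f) X)

/-- The first order operator `⟨ξ, D_x⟩ - ⟨x, D_ξ⟩`, where `D = -i ∂`. -/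
def rotX {d : ℕ} (f : Phase d → ℂ) (X : Phase d) : ℂ :=
  ∑ j, (X.2 j : ℂ) * (-Complex.I * dX j f X) - ∑ j, (X.1 j : ℂ) * (-Complex.I * dXi j f X)

/-- `H_σ = (|X|² - ¼ Δ_X) + ⟨ξ, D_x⟩ - ⟨x, D_ξ⟩`. -/
def Hσ {d : ℕ} (f : Phase d → ℂ) (X : Phase d) : ℂ :=
  ((‖X.1‖ ^ 2 + ‖X.2‖ ^ 2 : ℝ) : ℂ) * f X - (1 / 4 : ℂ) * laplX f X + rotX f X

/-- `H̄_σ = (|X|² - ¼ Δ_X) - ⟨ξ, D_x⟩ + ⟨x, D_ξ⟩`. -/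
def HσBar {d : ℕ} (f : Phase d → ℂ) (X : Phase d) : ℂ :=
  ((‖X.1‖ ^ 2 + ‖X.2‖ ^ 2 : ℝ) : ℂ) * f X - (1 / 4 : ℂ) * laplX f X - rotX f X

/-- `T_σ = H_σ ∘ H̄_σ`. -/
def Tσ {d : ℕ} (f : Phase d → ℂ) : Phase d → ℂ := Hσ (HσBar f)

end TwistedPilipovic

end

noncomputable section

namespace TwistedPilipovic

/-! The Hermite-Wong functions are joint eigenfunctions of `H_σ` and `H̄_σ`, with eigenvalues `2|α₁|
+ d` and `2|α₂| + d`. Hence `T_σ^N` multiplies `c_α` by the `N`-th power of `λ_α = (2|α₁| + d)(2|α₂|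
+ d)`. Since `|ϱ_α| ≤ 1` everywhere, the sup norm of `T_σ^N a` is at most `∑ |c_α| λ_α^N`, and the
rest is a comparison of exponential decay with factorials.

Eigenfunctions. Everything factors over the `d` degrees of freedom (`hermiteWong_eq_prod`), so `d =
1` suffices. Let `x_L, ∂_L` and `x_R, ∂_R` denote position and derivative in the arguments `y/2 - x`
and `y/2 + x` of the two Hermite factors; by the ladder relations they act on the indices `m` and
`n`. Under the integral, `x = (x_R - x_L)/2`, `ξ = (i/2)(∂_L + ∂_R)` (integration by parts in `y`),
`∂_x = ∂_R - ∂_L` and `∂_ξ = i(x_L + x_R)`. Thus `|X|² - Δ/4` is half the sum, and `ξ D_x - x D_ξ`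
half the difference, of the oscillators `x_L² - ∂_L²` and `x_R² - ∂_R²`, whose eigenvalues are `2m +
1` and `2n + 1`.

Termwise action. The same relations write the derivative of `ϱ_α` as a combination of neighbouring
`ϱ_β` with coefficients `O(1 + |α|)`. So every derivative of `ϱ_α` is bounded, uniformly in `X`, by
a power of `1 + |α|` (`tame_hermiteWong`), and series with rapidly decaying coefficients are smooth
and may be differentiated termwise (`iterate_Tσ_tsum`).

Estimate. With `w = 1 + |α|` one has `λ_α ≤ ((2 + d) w)²`. Raising `(ρt)^N ≤ N! e^{ρt}`, `t =
w^{1/(2s)}`, to the power `4s` bounds `w^{2N}` by `ρ^{-4sN} (N!)^{4s} e^{4sρt}`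
(`pow_two_mul_le_factorial_mul_exp`). Coefficients of size `e^{-8sρt}` absorb the exponential and
leave a convergent sum, with `h = (2 + d) ρ^{-2s}`: some `ρ` gives some `h`, and all `ρ` give all
`h`. For `s = 0` the sums are finite. -/

/-! ### One-dimensional Hermite functions and their ladder relations. -/

/-- The `n`-th derivative of the Gaussian `exp (-t²)`. -/
def gaussDeriv (n : ℕ) : ℝ → ℝ := deriv^[n] (fun t => Real.exp (-t ^ 2))

theorem contDiff_gaussDeriv (n : ℕ) : ContDiff ℝ ((⊤ : ℕ∞) : WithTop ℕ∞) (gaussDeriv n) := by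
  rw [gaussDeriv]
  exact ContDiff.iterate_deriv n (by fun_prop)

theorem gaussDeriv_zero (x : ℝ) : gaussDeriv 0 x = Real.exp (-x ^ 2) := rfl

theorem hasDerivAt_gaussDeriv (n : ℕ) (x : ℝ) :
    HasDerivAt (gaussDeriv n) (gaussDeriv (n + 1) x) x := by
  have h := ((contDiff_gaussDeriv n).differentiable (by simp) x).hasDerivAt
  rwa [gaussDeriv, ← Function.iterate_succ_apply' deriv n] at h

theorem gaussDeriv_one (x : ℝ) : gaussDeriv 1 x = -2 * x * gaussDeriv 0 x := by
  have h : HasDerivAt (gaussDeriv 0) (-2 * x * gaussDeriv 0 x) x := by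
    have := ((hasDerivAt_pow 2 x).fun_neg).exp
    refine this.congr_deriv ?_
    rw [gaussDeriv_zero]
    push_cast
    ring
  exact (hasDerivAt_gaussDeriv 0 x).unique h

theorem gaussDeriv_add_two (n : ℕ) (x : ℝ) :
    gaussDeriv (n + 2) x = -2 * x * gaussDeriv (n + 1) x - 2 * (n + 1) * gaussDeriv n x := by
  induction n generalizing x with
  | zero =>
    have h1 := hasDerivAt_gaussDeriv 1 x
    have h2 : HasDerivAt (gaussDeriv 1)
        (-2 * 1 * gaussDeriv 0 x + -2 * x * gaussDeriv 1 x) x := by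
      rw [show gaussDeriv 1 = fun y => -2 * y * gaussDeriv 0 y from funext gaussDeriv_one]
      refine HasDerivAt.mul ?_ ((hasDerivAt_gaussDeriv 0 x).congr_deriv (gaussDeriv_one x))
      exact (hasDerivAt_id x).const_mul (-2)
    rw [h1.unique h2]; push_cast; ring
  | succ n ih =>
    have h1 := hasDerivAt_gaussDeriv (n + 2) x
    have h2 : HasDerivAt (gaussDeriv (n + 2))
        ((-2 * 1 * gaussDeriv (n + 1) x + -2 * x * gaussDeriv (n + 2) x)
          - 2 * (n + 1) * gaussDeriv (n + 1) x) x := by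
      rw [show gaussDeriv (n + 2) = fun y =>
        -2 * y * gaussDeriv (n + 1) y - 2 * (n + 1) * gaussDeriv n y from funext ih]
      refine HasDerivAt.sub (HasDerivAt.mul ?_ ?_) ((hasDerivAt_gaussDeriv n x).const_mul _)
      · exact (hasDerivAt_id x).const_mul (-2)
      · exact (hasDerivAt_gaussDeriv (n + 1) x).congr_deriv (ih x)
    rw [h1.unique h2]; push_cast; ring

/-- The normalising constant `π^{-1/4} (-1)^n (2^n n!)^{-1/2}` of the Hermite functions. -/
def hermiteNorm (n : ℕ) : ℝ :=
  Real.pi ^ (-(1 : ℝ) / 4) * (-1) ^ n * ((2 : ℝ) ^ n * (n.factorial : ℝ)) ^ (-(1 : ℝ) / 2)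

/-- The one-dimensional Hermite function of order `n`. -/
def hermite1 (n : ℕ) (x : ℝ) : ℝ :=
  hermiteNorm n * Real.exp (x ^ 2 / 2) * gaussDeriv n x

/-- The coefficient `√(n/2)` of the ladder relations. -/
def ladderCoeff (n : ℕ) : ℝ := Real.sqrt (n / 2)

theorem ladderCoeff_zero : ladderCoeff 0 = 0 := by simp [ladderCoeff]

theorem ladderCoeff_mul_self (n : ℕ) : ladderCoeff n * ladderCoeff n = n / 2 :=
  Real.mul_self_sqrt (by positivity)

theorem ladderCoeff_nonneg (n : ℕ) : 0 ≤ ladderCoeff n := Real.sqrt_nonneg _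

theorem ladderCoeff_pos (n : ℕ) : 0 < ladderCoeff (n + 1) := Real.sqrt_pos.2 (by positivity)

theorem ladderCoeff_le (n : ℕ) : ladderCoeff n ≤ 1 + n := by
  rw [ladderCoeff, Real.sqrt_le_left (by positivity)]
  have : (0 : ℝ) ≤ n := n.cast_nonneg
  nlinarith

theorem hermiteNorm_succ (n : ℕ) :
    hermiteNorm n = -2 * ladderCoeff (n + 1) * hermiteNorm (n + 1) := by
  have h2 : ∀ y : ℝ, 0 ≤ y → y ^ (-(1 : ℝ) / 2) = (Real.sqrt y)⁻¹ := by
    intro y hy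
    rw [Real.sqrt_eq_rpow, ← Real.rpow_neg hy]; norm_num
  have hy : (0 : ℝ) < 2 ^ n * (n.factorial : ℝ) := by positivity
  have hn : (0 : ℝ) < (n + 1) / 2 := by positivity
  have e : (2 : ℝ) ^ (n + 1) * ((n + 1).factorial : ℝ)
      = (2 * 2) * (((n + 1) / 2) * (2 ^ n * (n.factorial : ℝ))) := by
    rw [Nat.factorial_succ]; push_cast; ring
  have hs : Real.sqrt ((2 : ℝ) ^ (n + 1) * ((n + 1).factorial : ℝ))
      = 2 * (Real.sqrt ((n + 1) / 2) * Real.sqrt (2 ^ n * (n.factorial : ℝ))) := by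
    rw [e, Real.sqrt_mul (by norm_num), Real.sqrt_mul_self (by norm_num),
      Real.sqrt_mul hn.le]
  rw [hermiteNorm, hermiteNorm, h2 _ hy.le, h2 _ (by positivity), hs, ladderCoeff]
  have a1 := (Real.sqrt_pos.2 hy).ne'
  have a2 := (Real.sqrt_pos.2 hn).ne'
  push_cast
  field_simp
  ring

theorem hasDerivAt_exp_half_sq (x : ℝ) :
    HasDerivAt (fun y : ℝ => Real.exp (y ^ 2 / 2)) (x * Real.exp (x ^ 2 / 2)) x := by
  have := ((hasDerivAt_pow 2 x).div_const 2).exp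
  convert this using 1
  simp; ring

/-- The recurrence of the Gaussian derivatives, normalised. At `n = 0` the truncated index `n - 1`
is harmless because `ladderCoeff 0 = 0`; the same convention is used in all ladder formulas below.
-/
theorem mul_hermite1 (n : ℕ) (x : ℝ) :
    x * hermite1 n x
      = ladderCoeff n * hermite1 (n - 1) x + ladderCoeff (n + 1) * hermite1 (n + 1) x := by
  cases n with
  | zero =>
    simp only [hermite1, ladderCoeff_zero, zero_add, gaussDeriv_one, hermiteNorm_succ 0]
    ring
  | succ n =>
    have h := gaussDeriv_add_two n x
    have h3 := ladderCoeff_mul_self (n + 1)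
    push_cast at h3
    simp only [hermite1, Nat.add_sub_cancel, h, hermiteNorm_succ n, hermiteNorm_succ (n + 1)]
    linear_combination (4 * ladderCoeff (n + 1 + 1) * hermiteNorm (n + 1 + 1)
      * Real.exp (x ^ 2 / 2) * gaussDeriv n x) * (-h3)

theorem hasDerivAt_hermite1 (n : ℕ) (x : ℝ) :
    HasDerivAt (hermite1 n)
      (ladderCoeff n * hermite1 (n - 1) x - ladderCoeff (n + 1) * hermite1 (n + 1) x) x := by
  have h := ((hasDerivAt_exp_half_sq x).const_mul (hermiteNorm n)).mul (hasDerivAt_gaussDeriv n x)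
  refine h.congr_deriv ?_
  have h2 := mul_hermite1 n x
  have h3 : hermiteNorm n * Real.exp (x ^ 2 / 2) * gaussDeriv (n + 1) x
      = -2 * ladderCoeff (n + 1) * hermite1 (n + 1) x := by
    rw [hermite1, hermiteNorm_succ n]; ring
  have h4 : hermiteNorm n * (x * Real.exp (x ^ 2 / 2)) * gaussDeriv n x = x * hermite1 n x := by
    rw [hermite1]; ring
  simp only [h3, h4]
  linarith

theorem continuous_hermite1 (n : ℕ) : Continuous (hermite1 n) :=
  continuous_iff_continuousAt.2 fun x => (hasDerivAt_hermite1 n x).continuousAt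

/-! ### Gaussian decay and normalisation of the Hermite functions. -/

/-- `f` decays like a Gaussian of every exponent smaller than `1/2`. -/
def GaussianDecay (f : ℝ → ℝ) : Prop :=
  ∀ b : ℝ, b < 1 / 2 → ∃ C : ℝ, ∀ x, |f x| ≤ C * Real.exp (-b * x ^ 2)

theorem GaussianDecay.lin_comb {f g : ℝ → ℝ} (hf : GaussianDecay f) (hg : GaussianDecay g)
    (r s : ℝ) : GaussianDecay (fun x => r * f x + s * g x) := by
  intro b hb
  obtain ⟨C, hC⟩ := hf b hb
  obtain ⟨D, hD⟩ := hg b hb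
  refine ⟨|r| * C + |s| * D, fun x => (abs_add_le _ _).trans ?_⟩
  rw [abs_mul, abs_mul, add_mul, mul_assoc, mul_assoc]
  gcongr
  exacts [hC x, hD x]

theorem GaussianDecay.id_mul {f : ℝ → ℝ} (hf : GaussianDecay f) :
    GaussianDecay (fun x => x * f x) := by
  intro b hb
  -- Half of the room left below the exponent `1/2`: the decay at `b + δ` pays for `|x| ≤ (1 + 1/δ)
  -- e^{δx²}`.
  set δ := (1 / 2 - b) / 2 with hδ
  have hδ0 : 0 < δ := by rw [hδ]; linarith
  obtain ⟨C, hC⟩ := hf (b + δ) (by rw [hδ]; linarith)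
  have hC0 : 0 ≤ C := by
    have := (abs_nonneg _).trans (hC 0)
    simpa using this
  refine ⟨(1 + 1 / δ) * C, fun x => ?_⟩
  have h1 : |x| ≤ (1 + 1 / δ) * Real.exp (δ * x ^ 2) := by
    have h2 := Real.add_one_le_exp (δ * x ^ 2)
    have h3 : |x| ≤ 1 + x ^ 2 := by
      rw [← sq_abs]; nlinarith [abs_nonneg x]
    have h4 : 1 + x ^ 2 ≤ (1 + 1 / δ) * (δ * x ^ 2 + 1) := by
      have : (1 + 1 / δ) * (δ * x ^ 2 + 1) = 1 + x ^ 2 + (δ * x ^ 2 + 1 / δ) := by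
        field_simp; ring
      rw [this]
      have : 0 ≤ δ * x ^ 2 + 1 / δ := by positivity
      linarith
    refine h3.trans (h4.trans ?_)
    gcongr
  calc |x * f x| = |x| * |f x| := abs_mul _ _
    _ ≤ ((1 + 1 / δ) * Real.exp (δ * x ^ 2)) * (C * Real.exp (-(b + δ) * x ^ 2)) := by
        gcongr
        exact hC x
    _ = (1 + 1 / δ) * C * (Real.exp (δ * x ^ 2) * Real.exp (-(b + δ) * x ^ 2)) := by ring
    _ = _ := by rw [← Real.exp_add]; congr 2; ring

/-- The multiplication relation, solved for its top term, is a two-step recurrence, so the induction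
carries consecutive pairs. -/
theorem gaussianDecay_hermite1_and_succ (n : ℕ) :
    GaussianDecay (hermite1 n) ∧ GaussianDecay (hermite1 (n + 1)) := by
  have key : ∀ n, GaussianDecay (hermite1 n) → GaussianDecay (hermite1 (n - 1)) →
      GaussianDecay (hermite1 (n + 1)) := by
    intro n h1 h2
    have := h1.id_mul.lin_comb h2 (ladderCoeff (n + 1))⁻¹
      (-((ladderCoeff (n + 1))⁻¹ * ladderCoeff n))
    convert this using 1
    funext x
    have h := mul_hermite1 n x
    have := (ladderCoeff_pos n).ne'
    rw [h]; field_simp; ring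
  have zero : GaussianDecay (hermite1 0) := by
    intro b hb
    refine ⟨|hermiteNorm 0|, fun x => ?_⟩
    rw [hermite1, gaussDeriv_zero, mul_assoc, ← Real.exp_add, abs_mul, Real.abs_exp]
    gcongr
    nlinarith [sq_nonneg x]
  induction n with
  | zero => exact ⟨zero, key 0 zero zero⟩
  | succ n ih => exact ⟨ih.2, key (n + 1) ih.2 ih.1⟩

theorem gaussianDecay_hermite1 (n : ℕ) : GaussianDecay (hermite1 n) :=
  (gaussianDecay_hermite1_and_succ n).1

theorem integrable_hermite1_mul (m n : ℕ) :
    MeasureTheory.Integrable (fun x => hermite1 m x * hermite1 n x) := by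
  obtain ⟨C, hC⟩ := gaussianDecay_hermite1 m (1 / 4) (by norm_num)
  obtain ⟨D, hD⟩ := gaussianDecay_hermite1 n (1 / 4) (by norm_num)
  refine ((integrable_exp_neg_mul_sq (b := 1 / 2) (by norm_num)).const_mul (C * D)).mono'
    ((continuous_hermite1 m).mul (continuous_hermite1 n)).aestronglyMeasurable
    (Filter.Eventually.of_forall fun x => ?_)
  rw [Real.norm_eq_abs, abs_mul]
  calc |hermite1 m x| * |hermite1 n x|
      ≤ (C * Real.exp (-(1 / 4) * x ^ 2)) * (D * Real.exp (-(1 / 4) * x ^ 2)) := by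
        gcongr
        exacts [(abs_nonneg _).trans (hC x), hC x, hD x]
    _ = C * D * (Real.exp (-(1 / 4) * x ^ 2) * Real.exp (-(1 / 4) * x ^ 2)) := by ring
    _ = _ := by rw [← Real.exp_add]; congr 2; ring

/-- The derivative of `h_n h_{n+1}` is a positive multiple of `h_n² - h_{n+1}²` and has integral
zero, so all the norms equal that of `h_0`, a Gaussian integral. -/
theorem integral_hermite1_sq (n : ℕ) : ∫ x, hermite1 n x * hermite1 n x = 1 := by
  induction n with
  | zero =>
    have h : ∀ x, hermite1 0 x * hermite1 0 x
        = (hermiteNorm 0 * hermiteNorm 0) * Real.exp (-1 * x ^ 2) := by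
      intro x
      have e : hermite1 0 x = hermiteNorm 0 * Real.exp (-x ^ 2 / 2) := by
        rw [hermite1, gaussDeriv_zero, mul_assoc, ← Real.exp_add]
        congr 2; ring
      rw [e, mul_mul_mul_comm, ← Real.exp_add]
      congr 2; ring
    simp_rw [h]
    rw [MeasureTheory.integral_const_mul, integral_gaussian]
    simp only [hermiteNorm, pow_zero, Nat.factorial_zero, Nat.cast_one, mul_one, Real.one_rpow,
      div_one]
    rw [← Real.rpow_add Real.pi_pos, Real.sqrt_eq_rpow, ← Real.rpow_add Real.pi_pos]
    norm_num
  | succ n ih =>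
    have hd : ∀ x, HasDerivAt (fun x => hermite1 n x * hermite1 (n + 1) x)
        ((ladderCoeff n * hermite1 (n - 1) x - ladderCoeff (n + 1) * hermite1 (n + 1) x)
            * hermite1 (n + 1) x
          + hermite1 n x * (ladderCoeff (n + 1) * hermite1 n x
            - ladderCoeff (n + 2) * hermite1 (n + 2) x)) x := fun x =>
      (hasDerivAt_hermite1 n x).mul (hasDerivAt_hermite1 (n + 1) x)
    -- Expanding `x h_n h_{n+1}` in two ways, through `x h_n` and through `x h_{n+1}`, eliminates
    -- the terms with indices `n - 1` and `n + 2`.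
    have hd2 : ∀ x, HasDerivAt (fun x => hermite1 n x * hermite1 (n + 1) x)
        (2 * ladderCoeff (n + 1) * (hermite1 n x * hermite1 n x)
          - 2 * ladderCoeff (n + 1) * (hermite1 (n + 1) x * hermite1 (n + 1) x)) x := by
      intro x
      refine (hd x).congr_deriv ?_
      have h1 := mul_hermite1 n x
      have h2 := mul_hermite1 (n + 1) x
      simp only [Nat.add_sub_cancel] at h2
      linear_combination (-hermite1 (n + 1) x) * h1 + hermite1 n x * h2
    have i1 := (integrable_hermite1_mul n n).const_mul (2 * ladderCoeff (n + 1))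
    have i2 := (integrable_hermite1_mul (n + 1) (n + 1)).const_mul (2 * ladderCoeff (n + 1))
    have h0 := MeasureTheory.integral_eq_zero_of_hasDerivAt_of_integrable hd2 (i1.sub i2)
      (integrable_hermite1_mul n (n + 1))
    rw [MeasureTheory.integral_sub i1 i2, MeasureTheory.integral_const_mul,
      MeasureTheory.integral_const_mul, ih] at h0
    have := ladderCoeff_pos n
    nlinarith


/-! ### Ladder operators on doubly indexed families -/

/-- Multiplication by the variable of the first factor, on Hermite coefficients. -/
def posL (F : ℕ → ℕ → ℂ) (m n : ℕ) : ℂ :=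
  (ladderCoeff m : ℂ) * F (m - 1) n + (ladderCoeff (m + 1) : ℂ) * F (m + 1) n

/-- Differentiation in the variable of the first factor, on Hermite coefficients. -/
def derL (F : ℕ → ℕ → ℂ) (m n : ℕ) : ℂ :=
  (ladderCoeff m : ℂ) * F (m - 1) n + (-ladderCoeff (m + 1) : ℂ) * F (m + 1) n

/-- Multiplication by the variable of the second factor, on Hermite coefficients. -/
def posR (F : ℕ → ℕ → ℂ) (m n : ℕ) : ℂ :=
  (ladderCoeff n : ℂ) * F m (n - 1) + (ladderCoeff (n + 1) : ℂ) * F m (n + 1)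

/-- Differentiation in the variable of the second factor, on Hermite coefficients. -/
def derR (F : ℕ → ℕ → ℂ) (m n : ℕ) : ℂ :=
  (ladderCoeff n : ℂ) * F m (n - 1) + (-ladderCoeff (n + 1) : ℂ) * F m (n + 1)

theorem ladderCoeff_mul_self_complex (n : ℕ) :
    (ladderCoeff n : ℂ) * (ladderCoeff n : ℂ) = n / 2 := by
  rw [← Complex.ofReal_mul, ladderCoeff_mul_self]
  push_cast
  rfl

theorem mul_hermite1_complex (n : ℕ) (x : ℝ) :
    (x : ℂ) * (hermite1 n x : ℂ) = (ladderCoeff n : ℂ) * (hermite1 (n - 1) x : ℂ)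
      + (ladderCoeff (n + 1) : ℂ) * (hermite1 (n + 1) x : ℂ) := by
  rw [← Complex.ofReal_mul, mul_hermite1]
  push_cast
  rfl

/-- The harmonic oscillator `x² - ∂²` in ladder form. It is purely algebraic, hence valid for
arbitrary families `F`, and applies to kernels and to their integrals alike. -/
theorem posL_posL_sub_derL_derL (F : ℕ → ℕ → ℂ) (m n : ℕ) :
    posL (posL F) m n - derL (derL F) m n = (2 * m + 1) * F m n := by
  have h1 := ladderCoeff_mul_self_complex (m + 1)
  have h0 := ladderCoeff_mul_self_complex m
  cases m with
  | zero =>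
    simp only [posL, derL, ladderCoeff_zero, Nat.add_sub_cancel]
    push_cast at h1 ⊢
    linear_combination 2 * F 0 n * h1
  | succ m =>
    simp only [posL, derL, Nat.add_sub_cancel]
    push_cast at h0 h1 ⊢
    linear_combination 2 * F (m + 1) n * h1 + 2 * F (m + 1) n * h0

theorem posR_posR_sub_derR_derR (F : ℕ → ℕ → ℂ) (m n : ℕ) :
    posR (posR F) m n - derR (derR F) m n = (2 * n + 1) * F m n :=
  posL_posL_sub_derL_derL (fun i j => F j i) n m

/-! ### The one-dimensional Hermite-Wong functions -/

/-- The integrand of the one-dimensional Hermite-Wong function. -/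
def wongKernel (m n : ℕ) (p : ℝ × ℝ) (y : ℝ) : ℂ :=
  (hermite1 m (2⁻¹ * y - p.1) : ℂ) * (hermite1 n (2⁻¹ * y + p.1) : ℂ)
    * Complex.exp (Complex.I * ((y * p.2 : ℝ) : ℂ))

/-- The Hermite-Wong function of order `(m, n)` on `ℝ²`. -/
def wong1 (m n : ℕ) (p : ℝ × ℝ) : ℂ :=
  (((2 * Real.pi) ^ (-(1 : ℝ) / 2) : ℝ) : ℂ) * ∫ y : ℝ, wongKernel m n p y

theorem norm_wongKernel (m n : ℕ) (p : ℝ × ℝ) (y : ℝ) :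
    ‖wongKernel m n p y‖ = |hermite1 m (2⁻¹ * y - p.1)| * |hermite1 n (2⁻¹ * y + p.1)| := by
  rw [wongKernel, norm_mul, norm_mul, mul_comm Complex.I, Complex.norm_exp_ofReal_mul_I,
    Complex.norm_real, Complex.norm_real, mul_one, Real.norm_eq_abs, Real.norm_eq_abs]

theorem continuous_wongKernel (m n : ℕ) (p : ℝ × ℝ) : Continuous (wongKernel m n p) := by
  have hm := continuous_hermite1 m
  have hn := continuous_hermite1 n
  have h1 : Continuous fun y : ℝ => 2⁻¹ * y - p.1 := by fun_prop
  have h2 : Continuous fun y : ℝ => 2⁻¹ * y + p.1 := by fun_prop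
  have h3 : Continuous fun y : ℝ => y * p.2 := by fun_prop
  exact ((Complex.continuous_ofReal.comp (hm.comp h1)).mul
    (Complex.continuous_ofReal.comp (hn.comp h2))).mul
    (Complex.continuous_exp.comp (continuous_const.mul (Complex.continuous_ofReal.comp h3)))

/-- Because `(y/2 - x)² + (y/2 + x)² ≥ y²/2`, the bound is uniform in `p`. It therefore serves as
dominating function when differentiating under the integral. -/
theorem exists_norm_wongKernel_le (m n : ℕ) :
    ∃ C : ℝ, ∀ p y, ‖wongKernel m n p y‖ ≤ C * Real.exp (-(1 / 8) * y ^ 2) := by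
  obtain ⟨C, hC⟩ := gaussianDecay_hermite1 m (1 / 4) (by norm_num)
  obtain ⟨D, hD⟩ := gaussianDecay_hermite1 n (1 / 4) (by norm_num)
  have hC0 : 0 ≤ C := by simpa using (abs_nonneg _).trans (hC 0)
  have hD0 : 0 ≤ D := by simpa using (abs_nonneg _).trans (hD 0)
  refine ⟨C * D, fun p y => ?_⟩
  rw [norm_wongKernel]
  calc _ ≤ (C * Real.exp (-(1 / 4) * (2⁻¹ * y - p.1) ^ 2))
        * (D * Real.exp (-(1 / 4) * (2⁻¹ * y + p.1) ^ 2)) := by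
        gcongr
        exacts [hC _, hD _]
    _ = C * D * (Real.exp (-(1 / 4) * (2⁻¹ * y - p.1) ^ 2)
          * Real.exp (-(1 / 4) * (2⁻¹ * y + p.1) ^ 2)) := by ring
    _ ≤ _ := by
        rw [← Real.exp_add]
        gcongr
        nlinarith [sq_nonneg p.1]

theorem integrable_wongKernel (m n : ℕ) (p : ℝ × ℝ) :
    MeasureTheory.Integrable (wongKernel m n p) := by
  obtain ⟨C, hC⟩ := exists_norm_wongKernel_le m n
  exact ((integrable_exp_neg_mul_sq (b := 1 / 8) (by norm_num)).const_mul C).mono'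
    (continuous_wongKernel m n p).aestronglyMeasurable (Filter.Eventually.of_forall (hC p))

theorem integral_comp_half_add (f : ℝ → ℝ) (a : ℝ) :
    ∫ y, f (2⁻¹ * y + a) = 2 * ∫ y, f y := by
  rw [MeasureTheory.Measure.integral_comp_mul_left (fun z => f (z + a)) 2⁻¹,
    MeasureTheory.integral_add_right_eq_self]
  norm_num

/-- By `2|uv| ≤ u² + v²` and the normalisation of the Hermite functions the integral is at most `2`,
the Jacobian of `y ↦ y/2`; the prefactor `(2π)^{-1/2}` is at most `1/2`. -/
theorem norm_wong1_le_one (m n : ℕ) (p : ℝ × ℝ) : ‖wong1 m n p‖ ≤ 1 := by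
  have im := (integrable_hermite1_mul m m)
  have i_n := (integrable_hermite1_mul n n)
  have jm := (im.comp_add_right (-p.1)).comp_mul_left' (R := (2⁻¹ : ℝ)) (by norm_num)
  have jn := (i_n.comp_add_right p.1).comp_mul_left' (R := (2⁻¹ : ℝ)) (by norm_num)
  have h1 : ‖∫ y : ℝ, wongKernel m n p y‖ ≤ 2 := by
    refine (MeasureTheory.norm_integral_le_integral_norm _).trans ?_
    have : ∀ y, ‖wongKernel m n p y‖ ≤
        2⁻¹ * (hermite1 m (2⁻¹ * y + -p.1) * hermite1 m (2⁻¹ * y + -p.1))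
        + 2⁻¹ * (hermite1 n (2⁻¹ * y + p.1) * hermite1 n (2⁻¹ * y + p.1)) := by
      intro y
      rw [norm_wongKernel, sub_eq_add_neg, ← abs_mul_abs_self (hermite1 m _),
        ← abs_mul_abs_self (hermite1 n _)]
      nlinarith [sq_nonneg (|hermite1 m (2⁻¹ * y + -p.1)| - |hermite1 n (2⁻¹ * y + p.1)|)]
    refine (MeasureTheory.integral_mono (integrable_wongKernel m n p).norm
      ((jm.const_mul 2⁻¹).add (jn.const_mul 2⁻¹)) this).trans ?_
    simp only [Pi.add_apply]
    rw [MeasureTheory.integral_add (jm.const_mul 2⁻¹) (jn.const_mul 2⁻¹),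
      MeasureTheory.integral_const_mul, MeasureTheory.integral_const_mul,
      integral_comp_half_add (fun y => hermite1 m y * hermite1 m y),
      integral_comp_half_add (fun y => hermite1 n y * hermite1 n y),
      integral_hermite1_sq, integral_hermite1_sq]
    norm_num
  have h2 : (2 * Real.pi) ^ (-(1 : ℝ) / 2) ≤ 2⁻¹ := by
    have : (-(1 : ℝ) / 2) = -(1 / 2) := by norm_num
    rw [this, Real.rpow_neg (by positivity), ← Real.sqrt_eq_rpow]
    gcongr
    apply Real.le_sqrt_of_sq_le
    nlinarith [Real.pi_gt_three]
  rw [wong1, norm_mul, Complex.norm_real, Real.norm_of_nonneg (by positivity)]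
  calc _ ≤ 2⁻¹ * (2 : ℝ) := by gcongr
    _ = 1 := by norm_num

theorem hasDerivAt_hermite1_comp {m : ℕ} {c : ℝ} {f : ℝ → ℝ} {f' t : ℝ} (hf : HasDerivAt f f' t)
    (hc : f t = c) : HasDerivAt (fun t => (hermite1 m (f t) : ℂ))
      (((ladderCoeff m * hermite1 (m - 1) c - ladderCoeff (m + 1) * hermite1 (m + 1) c) * f' : ℝ)
        : ℂ) t := by
  subst hc
  exact ((hasDerivAt_hermite1 m (f t)).comp t hf).ofReal_comp

/-- A linear form on `ℝ × ℝ` with complex values, given by its coordinates. -/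
def linForm (a b : ℂ) : ℝ × ℝ →L[ℝ] ℂ :=
  (ContinuousLinearMap.fst ℝ ℝ ℝ).smulRight a + (ContinuousLinearMap.snd ℝ ℝ ℝ).smulRight b

@[simp] theorem linForm_apply (a b : ℂ) (v : ℝ × ℝ) : linForm a b v = v.1 * a + v.2 * b := by
  simp [linForm]

theorem norm_linForm_le (a b : ℂ) : ‖linForm a b‖ ≤ ‖a‖ + ‖b‖ := by
  refine ContinuousLinearMap.opNorm_le_bound _ (by positivity) fun v => ?_
  rw [linForm_apply, add_mul]
  refine (norm_add_le _ _).trans ?_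
  rw [norm_mul, norm_mul, Complex.norm_real, Complex.norm_real, mul_comm, mul_comm ‖(v.2 : ℝ)‖]
  gcongr
  exacts [norm_fst_le v, norm_snd_le v]

theorem hasFDerivAt_hermite1_comp {m : ℕ} {f : ℝ × ℝ → ℝ} {f' : ℝ × ℝ →L[ℝ] ℝ} {p : ℝ × ℝ}
    (hf : HasFDerivAt f f' p) : HasFDerivAt (fun p => (hermite1 m (f p) : ℂ))
      (f'.smulRight ((ladderCoeff m * hermite1 (m - 1) (f p)
        - ladderCoeff (m + 1) * hermite1 (m + 1) (f p) : ℝ) : ℂ)) p := by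
  have h := (hasDerivAt_hermite1 m (f p)).ofReal_comp
  have := h.hasFDerivAt.comp p hf
  refine this.congr_fderiv ?_
  ext <;> simp

/-- The parameter `x` enters the two arguments with opposite signs, which gives `derR - derL`. The
factor `i y` coming from `∂_ξ` is split as `y = (y/2 - x) + (y/2 + x)`, which gives `posL + posR`.
-/
theorem hasFDerivAt_wongKernel (m n : ℕ) (p : ℝ × ℝ) (y : ℝ) :
    HasFDerivAt (fun p => wongKernel m n p y)
      (linForm (derR (fun m n => wongKernel m n p y) m n - derL (fun m n => wongKernel m n p y) m n)
        (Complex.I * (posL (fun m n => wongKernel m n p y) m n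
          + posR (fun m n => wongKernel m n p y) m n))) p := by
  have h1 : HasFDerivAt (fun p : ℝ × ℝ => 2⁻¹ * y - p.1) (-ContinuousLinearMap.fst ℝ ℝ ℝ) p :=
    hasFDerivAt_fst.const_sub _
  have h2 : HasFDerivAt (fun p : ℝ × ℝ => 2⁻¹ * y + p.1) (ContinuousLinearMap.fst ℝ ℝ ℝ) p :=
    hasFDerivAt_fst.const_add _
  have h3 : HasFDerivAt (fun p : ℝ × ℝ => Complex.I * ((y * p.2 : ℝ) : ℂ))
      ((ContinuousLinearMap.snd ℝ ℝ ℝ).smulRight (Complex.I * y)) p := by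
    have : (fun p : ℝ × ℝ => Complex.I * ((y * p.2 : ℝ) : ℂ))
        = (ContinuousLinearMap.snd ℝ ℝ ℝ).smulRight (Complex.I * y) := by
      funext p; simp; ring
    rw [this]
    exact ContinuousLinearMap.hasFDerivAt _
  have h := ((hasFDerivAt_hermite1_comp (m := m) h1).mul
    (hasFDerivAt_hermite1_comp (m := n) h2)).mul h3.cexp
  refine h.congr_fderiv ?_
  have em := mul_hermite1_complex m (2⁻¹ * y - p.1)
  have en := mul_hermite1_complex n (2⁻¹ * y + p.1)
  rw [Complex.ofReal_sub] at em
  rw [Complex.ofReal_add] at en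
  rw [Complex.ofReal_mul] at em en
  rw [Complex.ofReal_inv, Complex.ofReal_ofNat] at em en
  ext
  · simp [posL, posR, derL, derR, wongKernel]
    ring
  · simp [posL, posR, derL, derR, wongKernel]
    linear_combination (Complex.I * (hermite1 n (2⁻¹ * y + p.1) : ℂ)
      * Complex.exp (Complex.I * (y * p.2))) * em
      + (Complex.I * (hermite1 m (2⁻¹ * y - p.1) : ℂ)
      * Complex.exp (Complex.I * (y * p.2))) * en

theorem hasDerivAt_wongKernel (m n : ℕ) (p : ℝ × ℝ) (y : ℝ) :
    HasDerivAt (wongKernel m n p)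
      (2⁻¹ * (derL (fun m n => wongKernel m n p y) m n + derR (fun m n => wongKernel m n p y) m n)
        + Complex.I * p.2 * wongKernel m n p y) y := by
  have h1 : HasDerivAt (fun y : ℝ => 2⁻¹ * y - p.1) (2⁻¹) y := by
    simpa using ((hasDerivAt_id y).const_mul (2⁻¹ : ℝ)).sub_const p.1
  have h2 : HasDerivAt (fun y : ℝ => 2⁻¹ * y + p.1) (2⁻¹) y := by
    simpa using ((hasDerivAt_id y).const_mul (2⁻¹ : ℝ)).add_const p.1
  have h3 : HasDerivAt (fun y : ℝ => Complex.I * ((y * p.2 : ℝ) : ℂ)) (Complex.I * p.2) y := by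
    have := ((hasDerivAt_id y).mul_const p.2).ofReal_comp.const_mul Complex.I
    simpa using this
  have h := ((hasDerivAt_hermite1_comp (m := m) h1 rfl).mul
    (hasDerivAt_hermite1_comp (m := n) h2 rfl)).mul h3.cexp
  refine h.congr_deriv ?_
  simp [derL, derR, wongKernel]
  ring

theorem integrable_ladder {F : ℕ → ℕ → ℝ → ℂ} (hF : ∀ m n, MeasureTheory.Integrable (F m n))
    (a b : ℂ) (m n k l : ℕ) : MeasureTheory.Integrable (fun y => a * F m n y + b * F k l y) :=
  ((hF m n).const_mul a).add ((hF k l).const_mul b)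

theorem integral_ladder {F : ℕ → ℕ → ℝ → ℂ} (hF : ∀ m n, MeasureTheory.Integrable (F m n))
    (a b : ℂ) (m n k l : ℕ) :
    ∫ y, (a * F m n y + b * F k l y) = a * (∫ y, F m n y) + b * ∫ y, F k l y := by
  rw [MeasureTheory.integral_add ((hF m n).const_mul a) ((hF k l).const_mul b),
    MeasureTheory.integral_const_mul, MeasureTheory.integral_const_mul]

section

variable (m n : ℕ) (p : ℝ × ℝ)

theorem integrable_posL_wongKernel :
    MeasureTheory.Integrable (fun y => posL (fun m n => wongKernel m n p y) m n) :=
  integrable_ladder (F := fun m n => wongKernel m n p) (fun m n => integrable_wongKernel m n p) ..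

theorem integrable_posR_wongKernel :
    MeasureTheory.Integrable (fun y => posR (fun m n => wongKernel m n p y) m n) :=
  integrable_ladder (F := fun m n => wongKernel m n p) (fun m n => integrable_wongKernel m n p) ..

theorem integrable_derL_wongKernel :
    MeasureTheory.Integrable (fun y => derL (fun m n => wongKernel m n p y) m n) :=
  integrable_ladder (F := fun m n => wongKernel m n p) (fun m n => integrable_wongKernel m n p) ..

theorem integrable_derR_wongKernel :
    MeasureTheory.Integrable (fun y => derR (fun m n => wongKernel m n p y) m n) :=
  integrable_ladder (F := fun m n => wongKernel m n p) (fun m n => integrable_wongKernel m n p) ..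

theorem integral_posL_wongKernel :
    (((2 * Real.pi) ^ (-(1 : ℝ) / 2) : ℝ) : ℂ) * ∫ y, posL (fun m n => wongKernel m n p y) m n
      = posL (fun m n => wong1 m n p) m n := by
  simp only [posL, wong1]
  rw [integral_ladder (F := fun m n => wongKernel m n p) (fun m n => integrable_wongKernel m n p)]
  ring

theorem integral_posR_wongKernel :
    (((2 * Real.pi) ^ (-(1 : ℝ) / 2) : ℝ) : ℂ) * ∫ y, posR (fun m n => wongKernel m n p y) m n
      = posR (fun m n => wong1 m n p) m n := by
  simp only [posR, wong1]
  rw [integral_ladder (F := fun m n => wongKernel m n p) (fun m n => integrable_wongKernel m n p)]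
  ring

theorem integral_derL_wongKernel :
    (((2 * Real.pi) ^ (-(1 : ℝ) / 2) : ℝ) : ℂ) * ∫ y, derL (fun m n => wongKernel m n p y) m n
      = derL (fun m n => wong1 m n p) m n := by
  simp only [derL, wong1]
  rw [integral_ladder (F := fun m n => wongKernel m n p) (fun m n => integrable_wongKernel m n p)]
  ring

theorem integral_derR_wongKernel :
    (((2 * Real.pi) ^ (-(1 : ℝ) / 2) : ℝ) : ℂ) * ∫ y, derR (fun m n => wongKernel m n p y) m n
      = derR (fun m n => wong1 m n p) m n := by
  simp only [derR, wong1]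
  rw [integral_ladder (F := fun m n => wongKernel m n p) (fun m n => integrable_wongKernel m n p)]
  ring

/-- Under the integral, `2x` is the difference of the arguments `y/2 + x` and `y/2 - x`. -/
theorem fst_mul_wong1 :
    (p.1 : ℂ) * wong1 m n p
      = 2⁻¹ * (posR (fun m n => wong1 m n p) m n - posL (fun m n => wong1 m n p) m n) := by
  rw [← integral_posL_wongKernel, ← integral_posR_wongKernel, ← mul_sub,
    ← MeasureTheory.integral_sub (integrable_posR_wongKernel m n p)
      (integrable_posL_wongKernel m n p), wong1, mul_left_comm, mul_left_comm 2⁻¹]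
  congr 1
  rw [← MeasureTheory.integral_const_mul, ← MeasureTheory.integral_const_mul]
  congr 1
  funext y
  have em := mul_hermite1_complex m (2⁻¹ * y - p.1)
  have en := mul_hermite1_complex n (2⁻¹ * y + p.1)
  rw [Complex.ofReal_sub] at em
  rw [Complex.ofReal_add] at en
  rw [Complex.ofReal_mul] at em en
  rw [Complex.ofReal_inv, Complex.ofReal_ofNat] at em en
  simp only [posL, posR, wongKernel]
  linear_combination 2⁻¹ * (hermite1 m (2⁻¹ * y - p.1) : ℂ)
      * Complex.exp (Complex.I * ((y * p.2 : ℝ) : ℂ)) * en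
    - 2⁻¹ * (hermite1 n (2⁻¹ * y + p.1) : ℂ)
      * Complex.exp (Complex.I * ((y * p.2 : ℝ) : ℂ)) * em

/-- Integration by parts: the `y`-derivative of the kernel, which contains `iξ` from the
exponential, has integral zero. -/
theorem snd_mul_wong1 :
    (p.2 : ℂ) * wong1 m n p = Complex.I / 2
      * (derL (fun m n => wong1 m n p) m n + derR (fun m n => wong1 m n p) m n) := by
  have i1 := ((integrable_derL_wongKernel m n p).fun_add
    (integrable_derR_wongKernel m n p)).const_mul (2⁻¹ : ℂ)
  have i2 := (integrable_wongKernel m n p).const_mul (Complex.I * p.2)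
  have h := MeasureTheory.integral_eq_zero_of_hasDerivAt_of_integrable
    (hasDerivAt_wongKernel m n p) (i1.add i2) (integrable_wongKernel m n p)
  rw [MeasureTheory.integral_add i1 i2, MeasureTheory.integral_const_mul, MeasureTheory.integral_const_mul,
    MeasureTheory.integral_add (integrable_derL_wongKernel m n p)
      (integrable_derR_wongKernel m n p)] at h
  rw [← integral_derL_wongKernel, ← integral_derR_wongKernel, wong1]
  linear_combination (-Complex.I * (((2 * Real.pi) ^ (-(1 : ℝ) / 2) : ℝ) : ℂ)) * h
    + (p.2 : ℂ) * (((2 * Real.pi) ^ (-(1 : ℝ) / 2) : ℝ) : ℂ) * (∫ y, wongKernel m n p y)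
      * Complex.I_mul_I

theorem exists_norm_ladder_wongKernel_le (a b : ℂ) (k l : ℕ) :
    ∃ C : ℝ, ∀ p y, ‖a * wongKernel m n p y + b * wongKernel k l p y‖
      ≤ C * Real.exp (-(1 / 8) * y ^ 2) := by
  obtain ⟨C, hC⟩ := exists_norm_wongKernel_le m n
  obtain ⟨D, hD⟩ := exists_norm_wongKernel_le k l
  refine ⟨‖a‖ * C + ‖b‖ * D, fun p y => (norm_add_le _ _).trans ?_⟩
  rw [norm_mul, norm_mul, add_mul, mul_assoc, mul_assoc]
  gcongr
  exacts [hC p y, hD p y]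

theorem hasFDerivAt_wong1 :
    HasFDerivAt (wong1 m n)
      (linForm (derR (fun m n => wong1 m n p) m n - derL (fun m n => wong1 m n p) m n)
        (Complex.I * (posL (fun m n => wong1 m n p) m n
          + posR (fun m n => wong1 m n p) m n))) p := by
  obtain ⟨C1, h1⟩ := exists_norm_ladder_wongKernel_le (m - 1) n
    (ladderCoeff m) (ladderCoeff (m + 1)) (m + 1) n
  obtain ⟨C2, h2⟩ := exists_norm_ladder_wongKernel_le (m - 1) n
    (ladderCoeff m) (-ladderCoeff (m + 1)) (m + 1) n
  obtain ⟨C3, h3⟩ := exists_norm_ladder_wongKernel_le m (n - 1)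
    (ladderCoeff n) (ladderCoeff (n + 1)) m (n + 1)
  obtain ⟨C4, h4⟩ := exists_norm_ladder_wongKernel_le m (n - 1)
    (ladderCoeff n) (-ladderCoeff (n + 1)) m (n + 1)
  set F' : ℝ × ℝ → ℝ → (ℝ × ℝ →L[ℝ] ℂ) := fun p y =>
    (linForm (derR (fun m n => wongKernel m n p y) m n - derL (fun m n => wongKernel m n p y) m n)
        (Complex.I * (posL (fun m n => wongKernel m n p y) m n
          + posR (fun m n => wongKernel m n p y) m n))) with hF'
  have hA : MeasureTheory.Integrable (fun y => derR (fun m n => wongKernel m n p y) m n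
      - derL (fun m n => wongKernel m n p y) m n) :=
    (integrable_derR_wongKernel m n p).sub (integrable_derL_wongKernel m n p)
  have hB := ((integrable_posL_wongKernel m n p).fun_add
    (integrable_posR_wongKernel m n p)).const_mul Complex.I
  have hFi : MeasureTheory.Integrable (F' p) :=
    (((ContinuousLinearMap.smulRightL ℝ (ℝ × ℝ) ℂ (ContinuousLinearMap.fst ℝ ℝ ℝ)).integrable_comp
      hA).add ((ContinuousLinearMap.smulRightL ℝ (ℝ × ℝ) ℂ
        (ContinuousLinearMap.snd ℝ ℝ ℝ)).integrable_comp hB))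
  have h := hasFDerivAt_integral_of_dominated_of_fderiv_le (μ := MeasureTheory.volume)
    (F := wongKernel m n) (F' := F') (x₀ := p) (s := Set.univ)
    (bound := fun y => (C4 + C2 + (C1 + C3)) * Real.exp (-(1 / 8) * y ^ 2)) Filter.univ_mem
    (Filter.Eventually.of_forall fun q => (continuous_wongKernel m n q).aestronglyMeasurable)
    (integrable_wongKernel m n p) hFi.aestronglyMeasurable
    (Filter.Eventually.of_forall fun y q _ => by
      refine (norm_linForm_le _ _).trans ?_
      rw [norm_mul, Complex.norm_I, one_mul, add_mul, add_mul _ C2, add_mul C1]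
      refine add_le_add ((norm_sub_le _ _).trans ?_) ((norm_add_le _ _).trans ?_)
      exacts [add_le_add (h4 q y) (h2 q y), add_le_add (h1 q y) (h3 q y)])
    ((integrable_exp_neg_mul_sq (b := 1 / 8) (by norm_num)).const_mul _)
    (Filter.Eventually.of_forall fun y q _ => hasFDerivAt_wongKernel m n q y)
  refine (h.const_mul (((2 * Real.pi) ^ (-(1 : ℝ) / 2) : ℝ) : ℂ)).congr_fderiv ?_
  refine ContinuousLinearMap.ext fun v => ?_
  rw [smul_apply, ContinuousLinearMap.integral_apply hFi, linForm_apply,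
    ← integral_posL_wongKernel, ← integral_posR_wongKernel, ← integral_derL_wongKernel,
    ← integral_derR_wongKernel]
  simp only [hF', linForm_apply]
  rw [MeasureTheory.integral_add (hA.const_mul (v.1 : ℂ)) (hB.const_mul (v.2 : ℂ)),
    MeasureTheory.integral_const_mul, MeasureTheory.integral_const_mul,
    MeasureTheory.integral_const_mul,
    MeasureTheory.integral_sub (integrable_derR_wongKernel m n p) (integrable_derL_wongKernel m n p),
    MeasureTheory.integral_add (integrable_posL_wongKernel m n p) (integrable_posR_wongKernel m n p),
    smul_eq_mul]
  ring

theorem differentiable_wong1 : Differentiable ℝ (wong1 m n) :=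
  fun p => (hasFDerivAt_wong1 m n p).differentiableAt

theorem dirDeriv_fst_wong1 : dirDeriv (1, 0) (wong1 m n) = fun p =>
    (1 : ℂ) * derR (fun m n => wong1 m n p) m n
      + (-1 : ℂ) * derL (fun m n => wong1 m n p) m n := by
  funext p
  rw [dirDeriv, (hasFDerivAt_wong1 m n p).fderiv]
  simp; ring

theorem dirDeriv_snd_wong1 : dirDeriv (0, 1) (wong1 m n) = fun p =>
    Complex.I * posL (fun m n => wong1 m n p) m n
      + Complex.I * posR (fun m n => wong1 m n p) m n := by
  funext p
  rw [dirDeriv, (hasFDerivAt_wong1 m n p).fderiv]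
  simp; ring

end

theorem differentiable_lin_comb {f g : ℝ × ℝ → ℂ} (hf : Differentiable ℝ f)
    (hg : Differentiable ℝ g) (a b : ℂ) : Differentiable ℝ (fun p => a * f p + b * g p) :=
  (hf.const_mul a).add (hg.const_mul b)

theorem dirDeriv_lin_comb {f g : ℝ × ℝ → ℂ} (hf : Differentiable ℝ f)
    (hg : Differentiable ℝ g) (a b : ℂ) (v p : ℝ × ℝ) :
    dirDeriv v (fun p => a * f p + b * g p) p = a * dirDeriv v f p + b * dirDeriv v g p := by
  rw [dirDeriv, (((hf p).hasFDerivAt.const_mul a).fun_add ((hg p).hasFDerivAt.const_mul b)).fderiv]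
  rfl

section

variable (m n : ℕ)

theorem differentiable_posL_wong1 :
    Differentiable ℝ (fun p => posL (fun m n => wong1 m n p) m n) :=
  differentiable_lin_comb (differentiable_wong1 _ _) (differentiable_wong1 _ _) _ _

theorem differentiable_posR_wong1 :
    Differentiable ℝ (fun p => posR (fun m n => wong1 m n p) m n) :=
  differentiable_lin_comb (differentiable_wong1 _ _) (differentiable_wong1 _ _) _ _

theorem differentiable_derL_wong1 :
    Differentiable ℝ (fun p => derL (fun m n => wong1 m n p) m n) :=
  differentiable_lin_comb (differentiable_wong1 _ _) (differentiable_wong1 _ _) _ _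

theorem differentiable_derR_wong1 :
    Differentiable ℝ (fun p => derR (fun m n => wong1 m n p) m n) :=
  differentiable_lin_comb (differentiable_wong1 _ _) (differentiable_wong1 _ _) _ _

theorem differentiable_dirDeriv_fst_wong1 : Differentiable ℝ (dirDeriv (1, 0) (wong1 m n)) := by
  rw [dirDeriv_fst_wong1]
  exact differentiable_lin_comb (differentiable_derR_wong1 m n) (differentiable_derL_wong1 m n) _ _

theorem differentiable_dirDeriv_snd_wong1 : Differentiable ℝ (dirDeriv (0, 1) (wong1 m n)) := by
  rw [dirDeriv_snd_wong1]
  exact differentiable_lin_comb (differentiable_posL_wong1 m n) (differentiable_posR_wong1 m n) _ _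

variable (v p : ℝ × ℝ)

theorem dirDeriv_posL_wong1 : dirDeriv v (fun p => posL (fun m n => wong1 m n p) m n) p
    = posL (fun m n => dirDeriv v (wong1 m n) p) m n :=
  dirDeriv_lin_comb (differentiable_wong1 _ _) (differentiable_wong1 _ _) _ _ v p

theorem dirDeriv_posR_wong1 : dirDeriv v (fun p => posR (fun m n => wong1 m n p) m n) p
    = posR (fun m n => dirDeriv v (wong1 m n) p) m n :=
  dirDeriv_lin_comb (differentiable_wong1 _ _) (differentiable_wong1 _ _) _ _ v p

theorem dirDeriv_derL_wong1 : dirDeriv v (fun p => derL (fun m n => wong1 m n p) m n) p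
    = derL (fun m n => dirDeriv v (wong1 m n) p) m n :=
  dirDeriv_lin_comb (differentiable_wong1 _ _) (differentiable_wong1 _ _) _ _ v p

theorem dirDeriv_derR_wong1 : dirDeriv v (fun p => derR (fun m n => wong1 m n p) m n) p
    = derR (fun m n => dirDeriv v (wong1 m n) p) m n :=
  dirDeriv_lin_comb (differentiable_wong1 _ _) (differentiable_wong1 _ _) _ _ v p

/-! ### Eigenvalue relations in one degree of freedom. -/

/-- The symmetric part `|X|² - Δ/4` of the twisted oscillator in one degree of freedom. -/
theorem wong1_symmetric_part :
    ((p.1 : ℂ) ^ 2 + (p.2 : ℂ) ^ 2) * wong1 m n p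
      - 4⁻¹ * (dirDeriv (1, 0) (dirDeriv (1, 0) (wong1 m n)) p
        + dirDeriv (0, 1) (dirDeriv (0, 1) (wong1 m n)) p) = (m + n + 1) * wong1 m n p := by
  have d1 : dirDeriv (1, 0) (dirDeriv (1, 0) (wong1 m n)) p =
      1 * derR (fun m n => 1 * derR (fun m n => wong1 m n p) m n
          + -1 * derL (fun m n => wong1 m n p) m n) m n
        + -1 * derL (fun m n => 1 * derR (fun m n => wong1 m n p) m n
          + -1 * derL (fun m n => wong1 m n p) m n) m n := by
    conv_lhs => rw [dirDeriv_fst_wong1]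
    rw [dirDeriv_lin_comb (differentiable_derR_wong1 m n) (differentiable_derL_wong1 m n),
      dirDeriv_derR_wong1, dirDeriv_derL_wong1]
    simp only [dirDeriv_fst_wong1]
  have d2 : dirDeriv (0, 1) (dirDeriv (0, 1) (wong1 m n)) p =
      Complex.I * posL (fun m n => Complex.I * posL (fun m n => wong1 m n p) m n
          + Complex.I * posR (fun m n => wong1 m n p) m n) m n
        + Complex.I * posR (fun m n => Complex.I * posL (fun m n => wong1 m n p) m n
          + Complex.I * posR (fun m n => wong1 m n p) m n) m n := by
    conv_lhs => rw [dirDeriv_snd_wong1]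
    rw [dirDeriv_lin_comb (differentiable_posL_wong1 m n) (differentiable_posR_wong1 m n),
      dirDeriv_posR_wong1, dirDeriv_posL_wong1]
    simp only [dirDeriv_snd_wong1]
  have x1 : ∀ m n, (p.1 : ℂ) * wong1 m n p = _ := fun m n => fst_mul_wong1 m n p
  have x2 : ∀ m n, (p.2 : ℂ) * wong1 m n p = _ := fun m n => snd_mul_wong1 m n p
  have q1 : (p.1 : ℂ) ^ 2 * wong1 m n p = 4⁻¹ *
      (posR (posR fun m n => wong1 m n p) m n - posR (posL fun m n => wong1 m n p) m n
        - posL (posR fun m n => wong1 m n p) m n + posL (posL fun m n => wong1 m n p) m n) := by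
    rw [sq, mul_assoc, x1]
    simp only [posL, posR] at x1 ⊢
    simp only [mul_add, mul_sub, mul_left_comm (p.1 : ℂ), x1]
    ring
  have q2 : (p.2 : ℂ) ^ 2 * wong1 m n p = -4⁻¹ *
      (derL (derL fun m n => wong1 m n p) m n + derL (derR fun m n => wong1 m n p) m n
        + derR (derL fun m n => wong1 m n p) m n + derR (derR fun m n => wong1 m n p) m n) := by
    rw [sq, mul_assoc, x2]
    simp only [derL, derR] at x2 ⊢
    simp only [mul_add, mul_left_comm (p.2 : ℂ), x2]
    ring_nf
    simp only [Complex.I_sq]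
    ring
  have eL := posL_posL_sub_derL_derL (fun m n => wong1 m n p) m n
  have eR := posR_posR_sub_derR_derR (fun m n => wong1 m n p) m n
  rw [d1, d2, add_mul, q1, q2]
  -- With `F` abstract only operator algebra remains: the mixed products of left and right operators
  -- cancel, leaving half the sum of the two oscillators.
  have goal : ∀ F : ℕ → ℕ → ℂ, posL (posL F) m n - derL (derL F) m n = (2 * m + 1) * F m n →
    posR (posR F) m n - derR (derR F) m n = (2 * n + 1) * F m n →
    4⁻¹ * (posR (posR F) m n - posR (posL F) m n - posL (posR F) m n + posL (posL F) m n) +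
      -4⁻¹ * (derL (derL F) m n + derL (derR F) m n + derR (derL F) m n + derR (derR F) m n) -
    4⁻¹ * (1 * derR (fun m n => 1 * derR F m n + -1 * derL F m n) m n +
        -1 * derL (fun m n => 1 * derR F m n + -1 * derL F m n) m n +
      (Complex.I * posL (fun m n => Complex.I * posL F m n + Complex.I * posR F m n) m n +
        Complex.I * posR (fun m n => Complex.I * posL F m n + Complex.I * posR F m n) m n)) =
    (m + n + 1) * F m n := by
    intro F eL eR
    have c1 : Complex.I * posL (fun m n => Complex.I * posL F m n + Complex.I * posR F m n) m n
        = -(posL (posL F) m n + posL (posR F) m n) := by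
      simp only [posL, posR] at *
      ring_nf; simp only [Complex.I_sq]; ring
    have c2 : Complex.I * posR (fun m n => Complex.I * posL F m n + Complex.I * posR F m n) m n
        = -(posR (posL F) m n + posR (posR F) m n) := by
      simp only [posL, posR] at *
      ring_nf; simp only [Complex.I_sq]; ring
    have c3 : derR (fun m n => 1 * derR F m n + -1 * derL F m n) m n
        = derR (derR F) m n - derR (derL F) m n := by
      simp only [derL, derR]; ring
    have c4 : derL (fun m n => 1 * derR F m n + -1 * derL F m n) m n
        = derL (derR F) m n - derL (derL F) m n := by
      simp only [derL, derR]; ring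
    rw [c1, c2, c3, c4]
    linear_combination 2⁻¹ * eL + 2⁻¹ * eR
  exact goal _ eL eR

/-- The rotation part `ξ D_x - x D_ξ` of the twisted oscillator in one degree of freedom. -/
theorem wong1_rotation_part :
    (p.2 : ℂ) * (-Complex.I * dirDeriv (1, 0) (wong1 m n) p)
      - (p.1 : ℂ) * (-Complex.I * dirDeriv (0, 1) (wong1 m n) p) = (m - n) * wong1 m n p := by
  have x1 : ∀ m n, (p.1 : ℂ) * wong1 m n p = _ := fun m n => fst_mul_wong1 m n p
  have x2 : ∀ m n, (p.2 : ℂ) * wong1 m n p = _ := fun m n => snd_mul_wong1 m n p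
  have eL := posL_posL_sub_derL_derL (fun m n => wong1 m n p) m n
  have eR := posR_posR_sub_derR_derR (fun m n => wong1 m n p) m n
  have q1 : (p.2 : ℂ) * (-Complex.I * dirDeriv (1, 0) (wong1 m n) p) = 2⁻¹ *
      (derR (derR fun m n => wong1 m n p) m n - derL (derL fun m n => wong1 m n p) m n) := by
    rw [dirDeriv_fst_wong1]
    simp only [derL, derR] at x2 ⊢
    simp only [mul_add, mul_left_comm (p.2 : ℂ), x2]
    ring_nf; simp only [Complex.I_sq]; ring
  have q2 : (p.1 : ℂ) * (-Complex.I * dirDeriv (0, 1) (wong1 m n) p) = 2⁻¹ *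
      (posR (posR fun m n => wong1 m n p) m n - posL (posL fun m n => wong1 m n p) m n) := by
    rw [dirDeriv_snd_wong1]
    simp only [posL, posR] at x1 ⊢
    simp only [mul_add, mul_left_comm (p.1 : ℂ), x1]
    ring_nf; simp only [Complex.I_sq]; ring
  rw [q1, q2]
  linear_combination 2⁻¹ * eL - 2⁻¹ * eR

end


/-! ### Products of functions of separate variables -/

/-- Allows a directional derivative to act on one factor of a product over the coordinates, the
others being constant along `v`. -/
theorem dirDeriv_mul_of_invariant {E 𝔸 : Type*} [NormedAddCommGroup E] [NormedSpace ℝ E]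
    [NormedCommRing 𝔸] [NormedAlgebra ℝ 𝔸] {g r : E → 𝔸} (hg : Differentiable ℝ g)
    (hr : Differentiable ℝ r) {v : E} (hv : ∀ x, ∀ t : ℝ, r (x + t • v) = r x) (x : E) :
    dirDeriv v (fun x => g x * r x) x = dirDeriv v g x * r x := by
  have h0 : fderiv ℝ r x v = 0 := by
    rw [← (hr x).lineDeriv_eq_fderiv, lineDeriv]
    simp [hv]
  rw [dirDeriv, dirDeriv, fderiv_fun_mul (hg x) (hr x)]
  simp [h0, mul_comm]

theorem differentiable_gaussDeriv (n : ℕ) : Differentiable ℝ (gaussDeriv n) :=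
  (contDiff_gaussDeriv n).differentiable (by simp)

variable {d : ℕ}

theorem e_apply_self (j : Fin d) : (e j : Conf d) j = 1 := by simp [e]

theorem e_apply_of_ne {i j : Fin d} (h : i ≠ j) : (e j : Conf d) i = 0 := by
  simp [e, h]

/-- The `j`-th coordinate on configuration space. -/
def coordCLM (j : Fin d) : Conf d →L[ℝ] ℝ := EuclideanSpace.proj j

theorem coordCLM_apply (j : Fin d) (x : Conf d) : coordCLM j x = x j := rfl

theorem dirDeriv_comp_coord {f f' : ℝ → ℝ} (hf : ∀ t, HasDerivAt f (f' t) t) (j : Fin d)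
    (x : Conf d) : dirDeriv (e j) (fun x : Conf d => f (x j)) x = f' (x j) := by
  have h := (hf (x j)).hasFDerivAt.comp x (coordCLM j).hasFDerivAt
  rw [dirDeriv]
  refine (congrArg (fun L => L (e j)) h.fderiv).trans ?_
  simp [coordCLM_apply, e_apply_self]

theorem differentiable_gaussDeriv_coord (n : ℕ) (j : Fin d) :
    Differentiable ℝ (fun x : Conf d => gaussDeriv n (x j)) :=
  (differentiable_gaussDeriv n).comp (coordCLM j).differentiable

theorem dirDeriv_prod_gaussDeriv (β : MultiIdx d) (j : Fin d) :
    dirDeriv (e j) (fun x : Conf d => ∏ i, gaussDeriv (β i) (x i))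
      = fun x => ∏ i, gaussDeriv (Function.update β j (β j + 1) i) (x i) := by
  funext x
  have h : (fun x : Conf d => ∏ i, gaussDeriv (β i) (x i)) = fun x : Conf d =>
      gaussDeriv (β j) (x j) * ∏ i ∈ Finset.univ.erase j, gaussDeriv (β i) (x i) := by
    funext x
    rw [Finset.mul_prod_erase _ (fun i => gaussDeriv (β i) (x i)) (Finset.mem_univ j)]
  have hr : Differentiable ℝ
      (fun x : Conf d => ∏ i ∈ Finset.univ.erase j, gaussDeriv (β i) (x i)) :=
    fun x => (HasFDerivAt.finsetProd (u := Finset.univ.erase j) fun i _ =>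
      (differentiable_gaussDeriv_coord (β i) i x).hasFDerivAt).differentiableAt
  rw [h, dirDeriv_mul_of_invariant (differentiable_gaussDeriv_coord _ j) hr,
    dirDeriv_comp_coord (hasDerivAt_gaussDeriv (β j)),
    ← Finset.mul_prod_erase Finset.univ
      (fun i => gaussDeriv (Function.update β j (β j + 1) i) (x i)) (Finset.mem_univ j)]
  · rw [Function.update_self]
    congr 1
    refine Finset.prod_congr rfl fun i hi => ?_
    rw [Function.update_of_ne (Finset.ne_of_mem_erase hi)]
  · intro x t
    refine Finset.prod_congr rfl fun i hi => ?_
    simp [e_apply_of_ne (Finset.ne_of_mem_erase hi)]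

theorem iterate_dirDeriv_prod_gaussDeriv (β : MultiIdx d) (j : Fin d) (k : ℕ) :
    (dirDeriv (e j))^[k] (fun x : Conf d => ∏ i, gaussDeriv (β i) (x i))
      = fun x => ∏ i, gaussDeriv (Function.update β j (β j + k) i) (x i) := by
  induction k with
  | zero => simp
  | succ k ih =>
    rw [Function.iterate_succ_apply', ih, dirDeriv_prod_gaussDeriv]
    simp [add_assoc]

/-- Absence of repetitions matters: each coordinate must still have order `0` when its own
derivatives are applied. -/
theorem foldr_dirDeriv_gauss (α : MultiIdx d) (l : List (Fin d)) (hl : l.Nodup) :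
    l.foldr (fun j g => (dirDeriv (e j))^[α j] g) (fun x : Conf d => ∏ i, gaussDeriv 0 (x i))
      = fun x => ∏ i, gaussDeriv (if i ∈ l then α i else 0) (x i) := by
  induction l with
  | nil => simp
  | cons j l ih =>
    rw [List.nodup_cons] at hl
    rw [List.foldr_cons, ih hl.2, iterate_dirDeriv_prod_gaussDeriv]
    funext x
    refine Finset.prod_congr rfl fun i _ => ?_
    by_cases hij : i = j
    · subst hij; simp [hl.1]
    · simp [hij]

theorem multiDeriv_gauss (α : MultiIdx d) (x : Conf d) :
    multiDeriv α (fun y => Real.exp (-‖y‖ ^ 2)) x = ∏ i, gaussDeriv (α i) (x i) := by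
  have h : (fun y : Conf d => Real.exp (-‖y‖ ^ 2)) = fun y => ∏ i, gaussDeriv 0 (y i) := by
    funext y
    simp only [gaussDeriv_zero]
    rw [← Real.exp_sum, EuclideanSpace.norm_sq_eq, ← Finset.sum_neg_distrib]
    simp
  rw [multiDeriv, h, foldr_dirDeriv_gauss α _ (List.nodup_finRange d)]
  simp

theorem rpow_natCast_mul_eq_prod {a : ℝ} (ha : 0 < a) (t : ℝ) :
    a ^ ((d : ℝ) * t) = ∏ _j : Fin d, a ^ t := by
  rw [Finset.prod_const, Finset.card_univ, Fintype.card_fin, mul_comm, Real.rpow_mul ha.le,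
    Real.rpow_natCast]

theorem hermiteFun_eq_prod (α : MultiIdx d) (x : Conf d) :
    hermiteFun α x = ∏ j, hermite1 (α j) (x j) := by
  have h1 : Real.pi ^ (-(d : ℝ) / 4) = ∏ _j : Fin d, Real.pi ^ (-(1 : ℝ) / 4) := by
    rw [← rpow_natCast_mul_eq_prod Real.pi_pos]; congr 1; ring
  have h2 : (-1 : ℝ) ^ len α = ∏ j, (-1 : ℝ) ^ α j := by
    rw [Finset.prod_pow_eq_pow_sum, len]
  have h3 : ((2 : ℝ) ^ len α * ∏ j, ((α j).factorial : ℝ)) ^ (-(1 : ℝ) / 2)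
      = ∏ j, ((2 : ℝ) ^ α j * ((α j).factorial : ℝ)) ^ (-(1 : ℝ) / 2) := by
    rw [Real.finsetProd_rpow _ _ (fun j _ => by positivity), Finset.prod_mul_distrib,
      Finset.prod_pow_eq_pow_sum, len]
  have h4 : Real.exp (‖x‖ ^ 2 / 2) = ∏ j, Real.exp (x j ^ 2 / 2) := by
    rw [← Real.exp_sum, EuclideanSpace.norm_sq_eq, Finset.sum_div]
    simp
  rw [hermiteFun, multiDeriv_gauss, h1, h2, h3, h4]
  simp only [hermite1, hermiteNorm, ← Finset.prod_mul_distrib]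

/-- The Gaussian, the exponential and the normalising constants all factor over coordinates, so
Fubini's theorem splits the integral. Lebesgue measure on Euclidean space is first transported to
the product measure on `Fin d → ℝ`. -/
theorem hermiteWong_eq_prod (α : MultiIdx d × MultiIdx d) (X : Phase d) :
    hermiteWong α X = ∏ j, wong1 (α.1 j) (α.2 j) (X.1 j, X.2 j) := by
  have hk : ∀ y : Fin d → ℝ,
      (hermiteFun α.1 ((2 : ℝ)⁻¹ • (WithLp.toLp 2 y : Conf d) - X.1) : ℂ)
          * (hermiteFun α.2 ((2 : ℝ)⁻¹ • (WithLp.toLp 2 y : Conf d) + X.1) : ℂ)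
          * Complex.exp (Complex.I * ((inner ℝ (WithLp.toLp 2 y : Conf d) X.2 : ℝ) : ℂ))
        = ∏ j, wongKernel (α.1 j) (α.2 j) (X.1 j, X.2 j) (y j) := by
    intro y
    have hi : (inner ℝ (WithLp.toLp 2 y : Conf d) X.2 : ℝ) = ∑ j, y j * X.2 j := by
      rw [PiLp.inner_apply]
      refine Finset.sum_congr rfl fun j _ => ?_
      simp [mul_comm]
    rw [hermiteFun_eq_prod, hermiteFun_eq_prod, hi, Complex.ofReal_prod, Complex.ofReal_prod,
      Complex.ofReal_sum, Finset.mul_sum, Complex.exp_sum, ← Finset.prod_mul_distrib,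
      ← Finset.prod_mul_distrib]
    rfl
  have hint := (PiLp.volume_preserving_toLp (Fin d)).integral_comp
    (MeasurableEquiv.toLp 2 (Fin d → ℝ)).measurableEmbedding
    (fun y : Conf d => (hermiteFun α.1 ((2 : ℝ)⁻¹ • y - X.1) : ℂ)
      * (hermiteFun α.2 ((2 : ℝ)⁻¹ • y + X.1) : ℂ)
      * Complex.exp (Complex.I * ((inner ℝ y X.2 : ℝ) : ℂ)))
  have hc : (2 * Real.pi) ^ (-(d : ℝ) / 2) = ∏ _j : Fin d, (2 * Real.pi) ^ (-(1 : ℝ) / 2) := by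
    rw [← rpow_natCast_mul_eq_prod (by positivity)]; congr 1; ring
  rw [hermiteWong, ← hint]
  simp_rw [hk]
  rw [MeasureTheory.integral_fintype_prod_volume_eq_prod
    (fun j => wongKernel (α.1 j) (α.2 j) (X.1 j, X.2 j)), hc, Complex.ofReal_prod,
    ← Finset.prod_mul_distrib]
  rfl

theorem norm_hermiteWong_le_one (α : MultiIdx d × MultiIdx d) (X : Phase d) :
    ‖hermiteWong α X‖ ≤ 1 := by
  rw [hermiteWong_eq_prod, norm_prod]
  exact Finset.prod_le_one (fun _ _ => norm_nonneg _) fun _ _ => norm_wong1_le_one _ _ _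

/-! ### The operators on phase space, one degree of freedom at a time. -/

/-- The projection of phase space onto its `j`-th degree of freedom. -/
def phaseProj (j : Fin d) : Phase d →L[ℝ] ℝ × ℝ :=
  ((coordCLM j).comp (ContinuousLinearMap.fst ℝ (Conf d) (Conf d))).prod
    ((coordCLM j).comp (ContinuousLinearMap.snd ℝ (Conf d) (Conf d)))

theorem phaseProj_apply (j : Fin d) (X : Phase d) : phaseProj j X = (X.1 j, X.2 j) := rfl

/-- The product of the factors of the Hermite-Wong function other than the `j`-th one. -/
def wongRest (α : MultiIdx d × MultiIdx d) (j : Fin d) (X : Phase d) : ℂ :=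
  ∏ i ∈ Finset.univ.erase j, wong1 (α.1 i) (α.2 i) (phaseProj i X)

theorem hermiteWong_eq_mul_rest (α : MultiIdx d × MultiIdx d) (j : Fin d) (X : Phase d) :
    hermiteWong α X = wong1 (α.1 j) (α.2 j) (phaseProj j X) * wongRest α j X := by
  rw [hermiteWong_eq_prod, wongRest]
  exact (Finset.mul_prod_erase _ (fun i => wong1 (α.1 i) (α.2 i) (phaseProj i X))
    (Finset.mem_univ j)).symm

theorem differentiable_wongRest (α : MultiIdx d × MultiIdx d) (j : Fin d) :
    Differentiable ℝ (wongRest α j) := by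
  have h : ∀ i, Differentiable ℝ fun X : Phase d => wong1 (α.1 i) (α.2 i) (phaseProj i X) :=
    fun i => (differentiable_wong1 (α.1 i) (α.2 i)).comp (phaseProj i).differentiable
  exact fun X => (HasFDerivAt.finsetProd (u := Finset.univ.erase j) fun i _ =>
    (h i X).hasFDerivAt).differentiableAt

theorem wongRest_add_smul (α : MultiIdx d × MultiIdx d) (j : Fin d) {v : Phase d}
    (hv : ∀ i, i ≠ j → phaseProj i v = 0) (X : Phase d) (t : ℝ) :
    wongRest α j (X + t • v) = wongRest α j X := by
  refine Finset.prod_congr rfl fun i hi => ?_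
  rw [map_add, map_smul, hv i (Finset.ne_of_mem_erase hi), smul_zero, add_zero]

theorem dirDeriv_mul_wongRest (α : MultiIdx d × MultiIdx d) (j : Fin d) {v : Phase d}
    (hv : ∀ i, i ≠ j → phaseProj i v = 0) {G : ℝ × ℝ → ℂ} (hG : Differentiable ℝ G) :
    dirDeriv v (fun X => G (phaseProj j X) * wongRest α j X)
      = fun X => dirDeriv (phaseProj j v) G (phaseProj j X) * wongRest α j X := by
  funext X
  have hc : Differentiable ℝ fun X : Phase d => G (phaseProj j X) :=
    hG.comp (phaseProj j).differentiable
  rw [dirDeriv_mul_of_invariant hc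
    (differentiable_wongRest α j) (wongRest_add_smul α j hv)]
  congr 1
  have := (hG (phaseProj j X)).hasFDerivAt.comp X (phaseProj j).hasFDerivAt
  rw [dirDeriv, dirDeriv]
  exact congrArg (fun L => L v) this.fderiv

theorem phaseProj_single_fst (j : Fin d) : phaseProj j ((e j, 0) : Phase d) = (1, 0) := by
  simp [phaseProj_apply, e_apply_self]

theorem phaseProj_single_snd (j : Fin d) : phaseProj j ((0, e j) : Phase d) = (0, 1) := by
  simp [phaseProj_apply, e_apply_self]

theorem phaseProj_single_fst_of_ne {i j : Fin d} (h : i ≠ j) :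
    phaseProj i ((e j, 0) : Phase d) = 0 := by
  simp [phaseProj_apply, e_apply_of_ne h]

theorem phaseProj_single_snd_of_ne {i j : Fin d} (h : i ≠ j) :
    phaseProj i ((0, e j) : Phase d) = 0 := by
  simp [phaseProj_apply, e_apply_of_ne h]

theorem dX_mul_wongRest (α : MultiIdx d × MultiIdx d) (j : Fin d) {G : ℝ × ℝ → ℂ}
    (hG : Differentiable ℝ G) : dX j (fun X => G (phaseProj j X) * wongRest α j X)
      = fun X => dirDeriv (1, 0) G (phaseProj j X) * wongRest α j X := by
  rw [dX, dirDeriv_mul_wongRest α j (fun i hi => phaseProj_single_fst_of_ne hi) hG,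
    phaseProj_single_fst]

theorem dXi_mul_wongRest (α : MultiIdx d × MultiIdx d) (j : Fin d) {G : ℝ × ℝ → ℂ}
    (hG : Differentiable ℝ G) : dXi j (fun X => G (phaseProj j X) * wongRest α j X)
      = fun X => dirDeriv (0, 1) G (phaseProj j X) * wongRest α j X := by
  rw [dXi, dirDeriv_mul_wongRest α j (fun i hi => phaseProj_single_snd_of_ne hi) hG,
    phaseProj_single_snd]

theorem symmetric_part_hermiteWong (α : MultiIdx d × MultiIdx d) (X : Phase d) :
    ((‖X.1‖ ^ 2 + ‖X.2‖ ^ 2 : ℝ) : ℂ) * hermiteWong α X - (1 / 4 : ℂ) * laplX (hermiteWong α) X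
      = (len α.1 + len α.2 + d : ℕ) * hermiteWong α X := by
  have h : ∀ j : Fin d, ((X.1 j : ℂ) ^ 2 + (X.2 j : ℂ) ^ 2) * hermiteWong α X
      - (1 / 4 : ℂ) * (dX j (dX j (hermiteWong α)) X + dXi j (dXi j (hermiteWong α)) X)
      = (α.1 j + α.2 j + 1) * hermiteWong α X := by
    intro j
    have e := wong1_symmetric_part (α.1 j) (α.2 j) (phaseProj j X)
    rw [show hermiteWong α = _ from funext (hermiteWong_eq_mul_rest α j),
      dX_mul_wongRest α j (differentiable_wong1 _ _), dXi_mul_wongRest α j (differentiable_wong1 _ _),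
      dX_mul_wongRest α j (differentiable_dirDeriv_fst_wong1 _ _),
      dXi_mul_wongRest α j (differentiable_dirDeriv_snd_wong1 _ _)]
    simp only [phaseProj_apply] at *
    linear_combination wongRest α j X * e
  have hs := Finset.sum_congr (rfl : (Finset.univ : Finset (Fin d)) = Finset.univ) fun j _ => h j
  rw [Finset.sum_sub_distrib, ← Finset.sum_mul, ← Finset.mul_sum, ← Finset.sum_mul] at hs
  rw [laplX, EuclideanSpace.norm_sq_eq, EuclideanSpace.norm_sq_eq]
  simp only [Real.norm_eq_abs, sq_abs, len]
  push_cast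
  rw [← Finset.sum_add_distrib, hs]
  simp [Finset.sum_add_distrib]

theorem rotX_hermiteWong (α : MultiIdx d × MultiIdx d) (X : Phase d) :
    rotX (hermiteWong α) X = ((len α.1 : ℂ) - len α.2) * hermiteWong α X := by
  have h : ∀ j : Fin d, (X.2 j : ℂ) * (-Complex.I * dX j (hermiteWong α) X)
      - (X.1 j : ℂ) * (-Complex.I * dXi j (hermiteWong α) X)
      = (α.1 j - α.2 j) * hermiteWong α X := by
    intro j
    have e := wong1_rotation_part (α.1 j) (α.2 j) (phaseProj j X)
    rw [show hermiteWong α = _ from funext (hermiteWong_eq_mul_rest α j),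
      dX_mul_wongRest α j (differentiable_wong1 _ _), dXi_mul_wongRest α j (differentiable_wong1 _ _)]
    simp only [phaseProj_apply] at *
    linear_combination wongRest α j X * e
  rw [rotX, ← Finset.sum_sub_distrib, Finset.sum_congr rfl fun j _ => h j, ← Finset.sum_mul]
  simp [len, Finset.sum_sub_distrib]

/-- The Hermite-Wong functions are eigenfunctions of `H_σ`. -/
theorem Hσ_hermiteWong (α : MultiIdx d × MultiIdx d) (X : Phase d) :
    Hσ (hermiteWong α) X = (2 * len α.1 + d : ℕ) * hermiteWong α X := by
  rw [Hσ, symmetric_part_hermiteWong, rotX_hermiteWong]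
  push_cast
  ring

/-- The Hermite-Wong functions are eigenfunctions of `H̄_σ`. -/
theorem HσBar_hermiteWong (α : MultiIdx d × MultiIdx d) (X : Phase d) :
    HσBar (hermiteWong α) X = (2 * len α.2 + d : ℕ) * hermiteWong α X := by
  rw [HσBar, symmetric_part_hermiteWong, rotX_hermiteWong]
  push_cast
  ring


/-! ### Families of smooth functions with polynomially bounded derivatives -/

section Tame

variable {I E : Type*} [NormedAddCommGroup E] [NormedSpace ℝ E]

/-- A family of smooth functions all of whose derivatives are bounded by powers of the weight
`w`. -/
def Tame (w : I → ℝ) (f : I → E → ℂ) : Prop :=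
  (∀ i, ContDiff ℝ ((⊤ : ℕ∞) : WithTop ℕ∞) (f i)) ∧
    ∀ k : ℕ, ∃ C : ℝ, ∃ m : ℕ, 0 ≤ C ∧ ∀ i X, ‖iteratedFDeriv ℝ k (f i) X‖ ≤ C * w i ^ m

/-- A family of coefficients which is summable against every power of the weight `w`. -/
def RapidlyDecaying (w : I → ℝ) (c : I → ℂ) : Prop :=
  ∀ m : ℕ, Summable fun i => ‖c i‖ * w i ^ m

/-- Bootstrapping: the derivative of each member is a finite linear expression in members of the
same family, so `C^n` for all of them gives `C^{n+1}`. -/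
theorem contDiff_of_ladder {κ : Type*} [Fintype κ] {f : I → E → ℂ} {σ : κ → I → I}
    {L : κ → I → ℂ →L[ℝ] (E →L[ℝ] ℂ)}
    (hd : ∀ i X, HasFDerivAt (f i) (∑ k, L k i (f (σ k i) X)) X) (i : I) :
    ContDiff ℝ ((⊤ : ℕ∞) : WithTop ℕ∞) (f i) := by
  refine contDiff_infty.2 fun n => ?_
  induction n generalizing i with
  | zero =>
    exact contDiff_zero.2 (continuous_iff_continuousAt.2 fun X => (hd i X).continuousAt)
  | succ n ih =>
    push_cast
    refine contDiff_succ_iff_hasFDerivAt.2 ⟨_, ?_, hd i⟩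
    exact ContDiff.sum fun k _ => (L k i).contDiff.comp (ih (σ k i))

/-- Each differentiation moves to neighbouring indices, at most doubling the weight, and costs one
more power of it through `‖L k i‖`. This gives the constant `C * 2 ^ m` and the exponent `m + 1`. -/
theorem tame_of_ladder {κ : Type*} [Fintype κ] {w : I → ℝ} {f : I → E → ℂ} {σ : κ → I → I}
    {L : κ → I → ℂ →L[ℝ] (E →L[ℝ] ℂ)} {B : κ → ℝ} {K : ℝ}
    (hw : ∀ i, 1 ≤ w i) (hσ : ∀ k i, w (σ k i) ≤ 2 * w i) (hL : ∀ k i, ‖L k i‖ ≤ B k * w i)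
    (hK : ∀ i X, ‖f i X‖ ≤ K)
    (hd : ∀ i X, HasFDerivAt (f i) (∑ k, L k i (f (σ k i) X)) X) : Tame w f := by
  have hc := contDiff_of_ladder hd
  refine ⟨hc, fun k => ?_⟩
  induction k with
  | zero =>
    refine ⟨|K|, 0, abs_nonneg K, fun i X => ?_⟩
    rw [norm_iteratedFDeriv_zero, pow_zero, mul_one]
    exact (hK i X).trans (le_abs_self K)
  | succ k ih =>
    obtain ⟨C, m, hC, h⟩ := ih
    refine ⟨(∑ l, |B l|) * (C * 2 ^ m), m + 1, by positivity, fun i X => ?_⟩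
    have e : fderiv ℝ (f i) = fun X => ∑ l, (L l i ∘ f (σ l i)) X :=
      funext fun X => (hd i X).fderiv
    rw [← norm_iteratedFDeriv_fderiv, e, iteratedFDeriv_fun_sum_apply fun l _ =>
      (((L l i).contDiff.comp (hc (σ l i))).of_le (mod_cast le_top)).contDiffAt]
    refine (norm_sum_le _ _).trans ?_
    rw [Finset.sum_mul, Finset.sum_mul]
    refine Finset.sum_le_sum fun l _ => ?_
    have hwi : 0 ≤ w i := zero_le_one.trans (hw i)
    calc ‖iteratedFDeriv ℝ k (L l i ∘ f (σ l i)) X‖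
        ≤ ‖L l i‖ * ‖iteratedFDeriv ℝ k (f (σ l i)) X‖ :=
          (L l i).norm_iteratedFDeriv_comp_left (hc (σ l i)).contDiffAt (mod_cast le_top)
      _ ≤ (|B l| * w i) * (C * (2 * w i) ^ m) := by
          gcongr
          · exact (hL l i).trans (by gcongr; exact le_abs_self _)
          · refine (h _ X).trans ?_
            gcongr
            · exact zero_le_one.trans (hw _)
            · exact hσ l i
      _ = _ := by rw [mul_pow, pow_succ]; ring

variable {w : I → ℝ} {f : I → E → ℂ} {c : I → ℂ}

theorem Tame.dirDeriv (hf : Tame w f) (v : E) : Tame w (fun i => dirDeriv v (f i)) := by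
  have hc : ∀ i, ContDiff ℝ ((⊤ : ℕ∞) : WithTop ℕ∞) (fderiv ℝ (f i)) :=
    fun i => (hf.1 i).fderiv_right (by simp)
  refine ⟨fun i => (hc i).clm_apply contDiff_const, fun k => ?_⟩
  obtain ⟨C, m, hC, h⟩ := hf.2 (k + 1)
  refine ⟨‖v‖ * C, m, by positivity, fun i X => ?_⟩
  refine (norm_iteratedFDeriv_clm_apply_const (hc i).contDiffAt (mod_cast le_top)).trans ?_
  rw [norm_iteratedFDeriv_fderiv, mul_assoc]
  gcongr
  exact h i X

theorem Tame.summable_iteratedFDeriv (hf : Tame w f) (hc : RapidlyDecaying w c) (k : ℕ) :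
    ∃ u : I → ℝ, Summable u ∧ ∀ i X, ‖iteratedFDeriv ℝ k (fun X => c i * f i X) X‖ ≤ u i := by
  obtain ⟨C, m, -, h⟩ := hf.2 k
  refine ⟨fun i => C * (‖c i‖ * w i ^ m), (hc m).mul_left C, fun i X => ?_⟩
  have e : (fun X => c i * f i X) = fun X => c i • f i X := rfl
  rw [e, iteratedFDeriv_const_smul_apply' ((hf.1 i).of_le (mod_cast le_top)).contDiffAt,
    norm_smul]
  refine (mul_le_mul_of_nonneg_left (h i X) (norm_nonneg (c i))).trans_eq ?_
  ring

theorem Tame.contDiff_tsum (hf : Tame w f) (hc : RapidlyDecaying w c) :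
    ContDiff ℝ ((⊤ : ℕ∞) : WithTop ℕ∞) fun X => ∑' i, c i * f i X := by
  choose u hu hb using hf.summable_iteratedFDeriv hc
  exact _root_.contDiff_tsum (v := u) (fun i => contDiff_const.mul (hf.1 i)) (fun k _ => hu k)
    fun k i X _ => hb k i X

theorem Tame.summable (hf : Tame w f) (hc : RapidlyDecaying w c) (X : E) :
    Summable fun i => c i * f i X := by
  obtain ⟨u, hu, hb⟩ := hf.summable_iteratedFDeriv hc 0
  refine hu.of_norm_bounded fun i => ?_
  simpa using hb i X

theorem Tame.hasSum (hf : Tame w f) (hc : RapidlyDecaying w c) (X : E) :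
    HasSum (fun i => c i * f i X) (∑' i, c i * f i X) :=
  (hf.summable hc X).hasSum

theorem Tame.dirDeriv_tsum (hf : Tame w f) (hc : RapidlyDecaying w c) (v : E) :
    TwistedPilipovic.dirDeriv v (fun X => ∑' i, c i * f i X)
      = fun X => ∑' i, c i * TwistedPilipovic.dirDeriv v (f i) X := by
  funext X
  obtain ⟨u, hu, hb⟩ := hf.summable_iteratedFDeriv hc 1
  have hdf : ∀ i, Differentiable ℝ (f i) := fun i => (hf.1 i).differentiable (by simp)
  have hb' : ∀ i X, ‖fderiv ℝ (fun X => c i * f i X) X‖ ≤ u i := by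
    intro i X
    have := hb i X
    rwa [← norm_iteratedFDeriv_fderiv, norm_iteratedFDeriv_zero] at this
  have h := fderiv_tsum_apply hu (fun i => (hdf i).const_mul (c i)) hb' (hf.summable hc X) X
  rw [TwistedPilipovic.dirDeriv, h]
  have hs : Summable fun i => fderiv ℝ (fun X => c i * f i X) X :=
    hu.of_norm_bounded fun i => hb' i X
  rw [← ContinuousLinearMap.apply_apply (𝕜 := ℝ) v, ContinuousLinearMap.map_tsum _ hs]
  refine tsum_congr fun i => ?_
  rw [ContinuousLinearMap.apply_apply, fderiv_const_mul (hdf i X)]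
  rfl

/-- A multiplier of linear growth costs one power of the weight. It keeps the coefficients
admissible after each application of `H_σ` or `H̄_σ`. -/
theorem RapidlyDecaying.mul_of_norm_le (hc : RapidlyDecaying w c) (hw : ∀ i, 0 ≤ w i) {a : I → ℂ}
    {A : ℝ} (ha : ∀ i, ‖a i‖ ≤ A * w i) : RapidlyDecaying w (fun i => c i * a i) := by
  intro m
  refine ((hc (m + 1)).mul_left A).of_nonneg_of_le
    (fun i => mul_nonneg (norm_nonneg _) (pow_nonneg (hw i) m)) fun i => ?_
  have := hw i
  calc ‖c i * a i‖ * w i ^ m = ‖a i‖ * (‖c i‖ * w i ^ m) := by rw [norm_mul]; ring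
    _ ≤ (A * w i) * (‖c i‖ * w i ^ m) := by gcongr; exact ha i
    _ = _ := by ring

end Tame

/-! ### The Hermite-Wong functions form a tame family -/

/-- The weight `1 + |α|`. -/
def wongWeight (α : MultiIdx d × MultiIdx d) : ℝ := 1 + (len α.1 + len α.2 : ℕ)

theorem one_le_wongWeight (α : MultiIdx d × MultiIdx d) : 1 ≤ wongWeight α := by
  simp [wongWeight]; positivity

/-- The neighbours of an index with respect to the ladder operators in one degree of freedom. -/
def wongShift : Fin d × Fin 4 → MultiIdx d × MultiIdx d → MultiIdx d × MultiIdx d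
  | (j, 0), α => (Function.update α.1 j (α.1 j - 1), α.2)
  | (j, 1), α => (Function.update α.1 j (α.1 j + 1), α.2)
  | (j, 2), α => (α.1, Function.update α.2 j (α.2 j - 1))
  | (j, 3), α => (α.1, Function.update α.2 j (α.2 j + 1))

/-- The coefficient forms in the derivative of a one-dimensional Hermite-Wong function. -/
def wongForm (m n : ℕ) : Fin 4 → (ℝ × ℝ →L[ℝ] ℂ)
  | 0 => linForm (-ladderCoeff m) (Complex.I * ladderCoeff m)
  | 1 => linForm (ladderCoeff (m + 1)) (Complex.I * ladderCoeff (m + 1))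
  | 2 => linForm (ladderCoeff n) (Complex.I * ladderCoeff n)
  | 3 => linForm (-ladderCoeff (n + 1)) (Complex.I * ladderCoeff (n + 1))

/-- The coefficients in the derivative of a Hermite-Wong function. -/
def wongLadder (k : Fin d × Fin 4) (α : MultiIdx d × MultiIdx d) : ℂ →L[ℝ] (Phase d →L[ℝ] ℂ) :=
  (ContinuousLinearMap.lsmul ℝ ℂ).flip ((wongForm (α.1 k.1) (α.2 k.1) k.2).comp (phaseProj k.1))

theorem wongLadder_apply_apply (k : Fin d × Fin 4) (α : MultiIdx d × MultiIdx d) (z : ℂ)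
    (v : Phase d) :
    wongLadder k α z v = z * wongForm (α.1 k.1) (α.2 k.1) k.2 (phaseProj k.1 v) := rfl

theorem len_update (α : MultiIdx d) (j : Fin d) (n : ℕ) :
    len (Function.update α j n) + α j = len α + n := by
  rw [len, len, ← Finset.add_sum_erase _ _ (Finset.mem_univ j),
    ← Finset.add_sum_erase _ α (Finset.mem_univ j), Function.update_self,
    Finset.sum_congr rfl fun i hi => Function.update_of_ne (Finset.ne_of_mem_erase hi) n α]
  ring

theorem le_len (α : MultiIdx d) (j : Fin d) : α j ≤ len α :=
  Finset.single_le_sum (f := α) (fun _ _ => Nat.zero_le _) (Finset.mem_univ j)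

theorem wongWeight_wongShift_le (k : Fin d × Fin 4) (α : MultiIdx d × MultiIdx d) :
    wongWeight (wongShift k α) ≤ 2 * wongWeight α := by
  have key : len (wongShift k α).1 + len (wongShift k α).2 ≤ len α.1 + len α.2 + 1 := by
    obtain ⟨j, l⟩ := k
    have a1 := len_update α.1 j (α.1 j - 1)
    have a2 := len_update α.1 j (α.1 j + 1)
    have a3 := len_update α.2 j (α.2 j - 1)
    have a4 := len_update α.2 j (α.2 j + 1)
    fin_cases l <;> simp only [wongShift] <;> omega
  have : ((len (wongShift k α).1 + len (wongShift k α).2 : ℕ) : ℝ)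
      ≤ ((len α.1 + len α.2 + 1 : ℕ) : ℝ) := by exact_mod_cast key
  have h2 : (0 : ℝ) ≤ (len α.1 + len α.2 : ℕ) := Nat.cast_nonneg _
  rw [wongWeight, wongWeight]
  push_cast at *
  linarith

theorem norm_wongForm_le (m n : ℕ) (l : Fin 4) : ‖wongForm m n l‖ ≤ 4 * (1 + (m + n : ℕ)) := by
  have key : ∀ k : ℕ, k ≤ m + n + 1 → 2 * ladderCoeff k ≤ 4 * (1 + (m + n : ℕ)) := by
    intro k hk
    have h1 := ladderCoeff_le k
    have h2 : (k : ℝ) ≤ (m + n : ℕ) + 1 := by exact_mod_cast hk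
    have h3 : (0 : ℝ) ≤ (m + n : ℕ) := Nat.cast_nonneg _
    linarith
  have h : ∀ (k : ℕ) (a b : ℂ), ‖a‖ = ladderCoeff k → ‖b‖ = ladderCoeff k → k ≤ m + n + 1 →
      ‖linForm a b‖ ≤ 4 * (1 + (m + n : ℕ)) := by
    intro k a b ha hb hk
    refine (norm_linForm_le a b).trans ?_
    rw [ha, hb, ← two_mul]
    exact key k hk
  have hn : ∀ k, ‖(ladderCoeff k : ℂ)‖ = ladderCoeff k := fun k => by
    rw [Complex.norm_real, Real.norm_of_nonneg (ladderCoeff_nonneg k)]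
  fin_cases l
  · exact h m _ _ (by rw [norm_neg, hn]) (by simp [hn, -Complex.norm_real]) (by omega)
  · exact h (m + 1) _ _ (hn _) (by simp [hn, -Complex.norm_real]) (by omega)
  · exact h n _ _ (hn _) (by simp [hn, -Complex.norm_real]) (by omega)
  · exact h (n + 1) _ _ (by rw [norm_neg, hn]) (by simp [hn, -Complex.norm_real]) (by omega)

theorem norm_wongLadder_le (k : Fin d × Fin 4) (α : MultiIdx d × MultiIdx d) :
    ‖wongLadder k α‖ ≤ (4 * ‖(phaseProj k.1 : Phase d →L[ℝ] ℝ × ℝ)‖) * wongWeight α := by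
  have hw := zero_le_one.trans (one_le_wongWeight α)
  refine ContinuousLinearMap.opNorm_le_bound _ (by positivity) fun z => ?_
  refine ContinuousLinearMap.opNorm_le_bound _ (by positivity) fun v => ?_
  rw [wongLadder_apply_apply, norm_mul]
  have h1 : ‖wongForm (α.1 k.1) (α.2 k.1) k.2‖ ≤ 4 * wongWeight α := by
    refine (norm_wongForm_le _ _ _).trans ?_
    rw [wongWeight]
    have : ((α.1 k.1 + α.2 k.1 : ℕ) : ℝ) ≤ (len α.1 + len α.2 : ℕ) := by
      exact_mod_cast add_le_add (le_len α.1 k.1) (le_len α.2 k.1)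
    linarith
  have h2 : ‖wongForm (α.1 k.1) (α.2 k.1) k.2 (phaseProj k.1 v)‖
      ≤ (4 * wongWeight α) * (‖(phaseProj k.1 : Phase d →L[ℝ] ℝ × ℝ)‖ * ‖v‖) :=
    (ContinuousLinearMap.le_opNorm _ _).trans
      (mul_le_mul h1 (ContinuousLinearMap.le_opNorm _ _) (norm_nonneg _) (by positivity))
  calc ‖z‖ * _ ≤ ‖z‖ * ((4 * wongWeight α) *
        (‖(phaseProj k.1 : Phase d →L[ℝ] ℝ × ℝ)‖ * ‖v‖)) := by gcongr
    _ = _ := by ring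

theorem wong1_mul_wongRest_of_eq_off {α β : MultiIdx d × MultiIdx d} (j : Fin d)
    (h : ∀ i, i ≠ j → α.1 i = β.1 i ∧ α.2 i = β.2 i) (X : Phase d) :
    wong1 (β.1 j) (β.2 j) (phaseProj j X) * wongRest α j X = hermiteWong β X := by
  rw [hermiteWong_eq_mul_rest β j]
  congr 1
  refine Finset.prod_congr rfl fun i hi => ?_
  rw [(h i (Finset.ne_of_mem_erase hi)).1, (h i (Finset.ne_of_mem_erase hi)).2]

theorem hermiteWong_wongShift (j : Fin d) (α : MultiIdx d × MultiIdx d) (X : Phase d) :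
    hermiteWong (wongShift (j, 0) α) X
        = wong1 (α.1 j - 1) (α.2 j) (phaseProj j X) * wongRest α j X ∧
    hermiteWong (wongShift (j, 1) α) X
        = wong1 (α.1 j + 1) (α.2 j) (phaseProj j X) * wongRest α j X ∧
    hermiteWong (wongShift (j, 2) α) X
        = wong1 (α.1 j) (α.2 j - 1) (phaseProj j X) * wongRest α j X ∧
    hermiteWong (wongShift (j, 3) α) X
        = wong1 (α.1 j) (α.2 j + 1) (phaseProj j X) * wongRest α j X := by
  refine ⟨?_, ?_, ?_, ?_⟩ <;>
  · rw [← wong1_mul_wongRest_of_eq_off (α := α) j fun i hi => by simp [wongShift, hi]]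
    simp [wongShift]

/-- Product rule: differentiating the `j`-th factor moves one of its two indices by one, which
produces the four neighbours in `wongShift`. -/
theorem hasFDerivAt_hermiteWong (α : MultiIdx d × MultiIdx d) (X : Phase d) :
    HasFDerivAt (hermiteWong α) (∑ k, wongLadder k α (hermiteWong (wongShift k α) X)) X := by
  have h := HasFDerivAt.finsetProd (u := Finset.univ) fun (j : Fin d) _ =>
    (hasFDerivAt_wong1 (α.1 j) (α.2 j) (phaseProj j X)).comp X (phaseProj j).hasFDerivAt
  have e : hermiteWong α = fun X => ∏ j, (wong1 (α.1 j) (α.2 j) ∘ phaseProj j) X :=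
    funext (hermiteWong_eq_prod α)
  rw [e]
  refine h.congr_fderiv ?_
  rw [Fintype.sum_prod_type]
  refine Finset.sum_congr rfl fun j _ => ?_
  obtain ⟨h0, h1, h2, h3⟩ := hermiteWong_wongShift j α X
  refine ContinuousLinearMap.ext fun v => ?_
  rw [Fin.sum_univ_four, h0, h1, h2, h3]
  simp only [add_apply, wongLadder_apply_apply, wongForm, linForm_apply, smul_apply,
    ContinuousLinearMap.comp_apply, smul_eq_mul, posL, posR, derL, derR]
  rw [show ∏ i ∈ Finset.univ.erase j, (wong1 (α.1 i) (α.2 i) ∘ phaseProj i) X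
    = wongRest α j X from rfl]
  ring

theorem tame_hermiteWong : Tame (wongWeight (d := d)) hermiteWong :=
  tame_of_ladder one_le_wongWeight wongWeight_wongShift_le norm_wongLadder_le
    norm_hermiteWong_le_one hasFDerivAt_hermiteWong

/-! ### Termwise application of the twisted oscillators -/

section Termwise

variable {c : MultiIdx d × MultiIdx d → ℂ}

theorem hasSum_laplX (hc : RapidlyDecaying wongWeight c) (X : Phase d) :
    HasSum (fun α => c α * laplX (hermiteWong α) X)
      (laplX (fun X => ∑' α, c α * hermiteWong α X) X) := by
  have ht := tame_hermiteWong (d := d)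
  simp only [laplX, dX, dXi, Finset.mul_sum, mul_add]
  refine hasSum_sum fun j _ => ?_
  rw [ht.dirDeriv_tsum hc, ht.dirDeriv_tsum hc, (ht.dirDeriv _).dirDeriv_tsum hc,
    (ht.dirDeriv _).dirDeriv_tsum hc]
  exact (((ht.dirDeriv _).dirDeriv _).hasSum hc X).add (((ht.dirDeriv _).dirDeriv _).hasSum hc X)

theorem hasSum_rotX (hc : RapidlyDecaying wongWeight c) (X : Phase d) :
    HasSum (fun α => c α * rotX (hermiteWong α) X)
      (rotX (fun X => ∑' α, c α * hermiteWong α X) X) := by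
  have ht := tame_hermiteWong (d := d)
  simp only [rotX, dX, dXi, Finset.mul_sum, mul_sub]
  refine HasSum.sub (hasSum_sum fun j _ => ?_) (hasSum_sum fun j _ => ?_)
  · rw [ht.dirDeriv_tsum hc]
    have := (((ht.dirDeriv (e j, 0)).hasSum hc X).mul_left (-Complex.I)).mul_left (X.2 j : ℂ)
    simpa only [mul_left_comm (c _)] using this
  · rw [ht.dirDeriv_tsum hc]
    have := (((ht.dirDeriv (0, e j)).hasSum hc X).mul_left (-Complex.I)).mul_left (X.1 j : ℂ)
    simpa only [mul_left_comm (c _)] using this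

/-- The series is differentiated termwise, the polynomial coefficients are constants at a fixed
point `X`, and each term is an eigenfunction. -/
theorem Hσ_tsum (hc : RapidlyDecaying wongWeight c) :
    Hσ (fun X : Phase d => ∑' α, c α * hermiteWong α X)
      = fun X => ∑' α, (c α * (2 * len α.1 + d : ℕ)) * hermiteWong α X := by
  funext X
  have h := (((tame_hermiteWong.hasSum hc X).mul_left ((‖X.1‖ ^ 2 + ‖X.2‖ ^ 2 : ℝ) : ℂ)).sub
    ((hasSum_laplX hc X).mul_left (1 / 4 : ℂ))).add (hasSum_rotX hc X)
  refine h.tsum_eq.symm.trans (tsum_congr fun α => ?_)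
  rw [mul_assoc (c α), ← Hσ_hermiteWong, Hσ]
  ring

theorem HσBar_tsum (hc : RapidlyDecaying wongWeight c) :
    HσBar (fun X : Phase d => ∑' α, c α * hermiteWong α X)
      = fun X => ∑' α, (c α * (2 * len α.2 + d : ℕ)) * hermiteWong α X := by
  funext X
  have h := (((tame_hermiteWong.hasSum hc X).mul_left ((‖X.1‖ ^ 2 + ‖X.2‖ ^ 2 : ℝ) : ℂ)).sub
    ((hasSum_laplX hc X).mul_left (1 / 4 : ℂ))).sub (hasSum_rotX hc X)
  refine h.tsum_eq.symm.trans (tsum_congr fun α => ?_)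
  rw [mul_assoc (c α), ← HσBar_hermiteWong, HσBar]
  ring

theorem RapidlyDecaying.mul_eigenvalue (hc : RapidlyDecaying wongWeight c)
    {n : MultiIdx d × MultiIdx d → ℕ} (hn : ∀ α, n α ≤ len α.1 + len α.2) :
    RapidlyDecaying wongWeight (fun α => c α * (2 * n α + d : ℕ)) := by
  refine hc.mul_of_norm_le (fun α => zero_le_one.trans (one_le_wongWeight α)) (A := 2 + d) ?_
  intro α
  rw [Complex.norm_natCast, wongWeight]
  have h1 : (n α : ℝ) ≤ (len α.1 + len α.2 : ℕ) := by exact_mod_cast hn α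
  have h2 : (0 : ℝ) ≤ (len α.1 + len α.2 : ℕ) := Nat.cast_nonneg _
  have h3 : (0 : ℝ) ≤ (d : ℝ) * (len α.1 + len α.2 : ℕ) := by positivity
  push_cast at *
  nlinarith

/-- The eigenvalue of `T_σ` on the Hermite-Wong function of order `α`. -/
def wongEigenvalue (α : MultiIdx d × MultiIdx d) : ℕ := (2 * len α.2 + d) * (2 * len α.1 + d)

theorem RapidlyDecaying.mul_wongEigenvalue (hc : RapidlyDecaying wongWeight c) :
    RapidlyDecaying wongWeight (fun α => c α * wongEigenvalue α) := by
  have h := (hc.mul_eigenvalue (n := fun α => len α.2) fun α => Nat.le_add_left _ _).mul_eigenvalue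
    (n := fun α => len α.1) fun α => Nat.le_add_right _ _
  simpa only [wongEigenvalue, Nat.cast_mul, mul_assoc] using h

theorem Tσ_tsum (hc : RapidlyDecaying wongWeight c) :
    Tσ (fun X : Phase d => ∑' α, c α * hermiteWong α X)
      = fun X => ∑' α, (c α * wongEigenvalue α) * hermiteWong α X := by
  rw [Tσ, HσBar_tsum hc, Hσ_tsum (hc.mul_eigenvalue fun α => Nat.le_add_left _ _)]
  simp only [wongEigenvalue, Nat.cast_mul, mul_assoc]

theorem RapidlyDecaying.mul_wongEigenvalue_pow (hc : RapidlyDecaying wongWeight c) (N : ℕ) :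
    RapidlyDecaying wongWeight (fun α => c α * (wongEigenvalue α : ℂ) ^ N) := by
  induction N with
  | zero => simpa using hc
  | succ N ih => simpa only [pow_succ, mul_assoc] using ih.mul_wongEigenvalue

theorem iterate_Tσ_tsum (hc : RapidlyDecaying wongWeight c) (N : ℕ) :
    Tσ^[N] (fun X : Phase d => ∑' α, c α * hermiteWong α X)
      = fun X => ∑' α, (c α * (wongEigenvalue α : ℂ) ^ N) * hermiteWong α X := by
  induction N with
  | zero => simp
  | succ N ih =>
    rw [Function.iterate_succ_apply', ih, Tσ_tsum (hc.mul_wongEigenvalue_pow N)]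
    simp only [pow_succ, mul_assoc]

theorem norm_iterate_Tσ_tsum_le (hc : RapidlyDecaying wongWeight c) (N : ℕ) (X : Phase d) :
    ‖Tσ^[N] (fun X : Phase d => ∑' α, c α * hermiteWong α X) X‖
      ≤ ∑' α, ‖c α‖ * (wongEigenvalue α : ℝ) ^ N := by
  rw [iterate_Tσ_tsum hc]
  have hs : Summable fun α => ‖c α‖ * (wongEigenvalue α : ℝ) ^ N := by
    simpa using (hc.mul_wongEigenvalue_pow N) 0
  refine tsum_of_norm_bounded hs.hasSum fun α => ?_
  rw [norm_mul, norm_mul, norm_pow, Complex.norm_natCast]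
  exact mul_le_of_le_one_right (by positivity) (norm_hermiteWong_le_one α X)

end Termwise


/-! ### Summability on multi-indices -/

theorem summable_prod_fin {g : ℕ → ℝ} (hg0 : ∀ n, 0 ≤ g n) (hg : Summable g) (d : ℕ) :
    Summable fun α : MultiIdx d => ∏ j, g (α j) := by
  induction d with
  | zero => exact Summable.of_finite
  | succ d ih =>
    rw [← (Fin.consEquiv fun _ => ℕ).summable_iff]
    have := hg.mul_of_nonneg ih hg0 fun α => Finset.prod_nonneg fun j _ => hg0 (α j)
    refine this.congr fun p => ?_
    simp [Fin.prod_univ_succ, Fin.consEquiv]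

/-- Each of the `2d` entries `k` of `α` satisfies `1 + k ≤ wongWeight α`, so two powers of the
weight per entry dominate the summable product of the `(1 + k)⁻²`. -/
theorem summable_inv_wongWeight_pow :
    Summable fun α : MultiIdx d × MultiIdx d => (wongWeight α ^ (2 * (d + d)))⁻¹ := by
  have hg : Summable fun n : ℕ => ((1 + n : ℝ) ^ 2)⁻¹ := by
    have := (summable_nat_add_iff 1).2 (Real.summable_nat_pow_inv.2 one_lt_two)
    refine this.congr fun n => ?_
    push_cast
    rw [add_comm]
  have h1 := summable_prod_fin (fun n => by positivity) hg d
  refine (h1.mul_of_nonneg h1 (fun α => by positivity) fun α => by positivity).of_nonneg_of_le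
    (fun α => inv_nonneg.2 (pow_nonneg (zero_le_one.trans (one_le_wongWeight α)) _)) fun α => ?_
  have key : ∀ β : MultiIdx d, (1 + len β : ℝ) ≤ wongWeight α →
      (wongWeight α ^ (2 * d))⁻¹ ≤ ∏ j, ((1 + β j : ℝ) ^ 2)⁻¹ := by
    intro β hβ
    rw [Finset.prod_inv_distrib]
    refine inv_anti₀ (by positivity) ?_
    have e : wongWeight α ^ (2 * d) = ∏ _j : Fin d, wongWeight α ^ 2 := by
      rw [Finset.prod_const, Finset.card_univ, Fintype.card_fin, pow_mul]
    rw [e]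
    refine Finset.prod_le_prod (fun j _ => by positivity) fun j _ => ?_
    gcongr
    refine le_trans ?_ hβ
    have : (β j : ℝ) ≤ len β := by exact_mod_cast le_len β j
    linarith
  rw [mul_add, pow_add, mul_inv]
  have hw := zero_le_one.trans (one_le_wongWeight α)
  refine mul_le_mul (key α.1 ?_) (key α.2 ?_) (by positivity) (by positivity)
  · rw [wongWeight]; push_cast
    have : (0 : ℝ) ≤ len α.2 := Nat.cast_nonneg _
    linarith
  · rw [wongWeight]; push_cast
    have : (0 : ℝ) ≤ len α.1 := Nat.cast_nonneg _
    linarith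

/-! ### Exponential weights against factorials -/

/-- The bound `(ρt)^N / N! ≤ e^{ρt}` at `t = w^{1/(2s)}`, raised to the power `4s`, since `t^{4sN} =
w^{2N}`. -/
theorem pow_two_mul_le_factorial_mul_exp {s ρ w : ℝ} (hs : 0 < s) (hρ : 0 < ρ) (hw : 0 < w)
    (N : ℕ) : w ^ (2 * N) ≤ (ρ ^ (-(2 * s))) ^ (2 * N) * (N.factorial : ℝ) ^ (4 * s)
      * Real.exp (4 * s * ρ * w ^ (1 / (2 * s))) := by
  set t := w ^ (1 / (2 * s)) with ht
  have ht0 : 0 < t := Real.rpow_pos_of_pos hw _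
  have h1 : (ρ * t) ^ N ≤ (N.factorial : ℝ) * Real.exp (ρ * t) := by
    have := Real.pow_div_factorial_le_exp (ρ * t) (by positivity) N
    rwa [div_le_iff₀' (by positivity)] at this
  have h2 := Real.rpow_le_rpow (by positivity) h1 (by positivity : 0 ≤ 4 * s)
  have hwt : w = t ^ (2 * s) := by
    rw [ht, ← Real.rpow_mul hw.le]
    field_simp
    simp
  have e1 : ((ρ * t) ^ N) ^ (4 * s) = (ρ ^ (2 * s)) ^ (2 * N) * w ^ (2 * N) := by
    rw [← mul_pow, hwt, ← Real.mul_rpow hρ.le ht0.le, ← Real.rpow_natCast, ← Real.rpow_natCast,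
      ← Real.rpow_mul (by positivity), ← Real.rpow_mul (by positivity)]
    congr 1
    push_cast
    ring
  rw [e1, Real.mul_rpow (by positivity) (Real.exp_pos _).le, ← Real.exp_mul] at h2
  rw [Real.rpow_neg hρ.le, inv_pow, mul_assoc, ← div_eq_inv_mul, le_div_iff₀' (by positivity)]
  refine h2.trans (le_of_eq ?_)
  congr 2
  ring

theorem summable_exp_mul_wongWeight_pow {s q : ℝ} (hs : 0 < s) (hq : 0 < q) (m : ℕ) :
    Summable fun α : MultiIdx d × MultiIdx d =>
      Real.exp (-q * wongWeight α ^ (1 / (2 * s))) * wongWeight α ^ m := by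
  -- Enough powers to absorb `w^m` and leave the summable inverse power. The factorial bound
  -- controls `w^{2p}`, which dominates `w^p` because `w ≥ 1`.
  set p := m + 2 * (d + d) with hp
  refine (summable_inv_wongWeight_pow.mul_left (((q / (4 * s)) ^ (-(2 * s))) ^ (2 * p)
    * (p.factorial : ℝ) ^ (4 * s))).of_nonneg_of_le (fun α => ?_) fun α => ?_
  · have := zero_le_one.trans (one_le_wongWeight α)
    positivity
  have hw1 := one_le_wongWeight α
  have hw : 0 < wongWeight α := zero_lt_one.trans_le hw1
  have h := pow_two_mul_le_factorial_mul_exp hs (by positivity : 0 < q / (4 * s)) hw p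
  rw [show 4 * s * (q / (4 * s)) = q by field_simp] at h
  rw [← div_eq_mul_inv, le_div_iff₀ (by positivity), mul_assoc, ← pow_add, ← hp, neg_mul,
    Real.exp_neg, ← div_eq_inv_mul, div_le_iff₀ (Real.exp_pos _)]
  exact (pow_le_pow_right₀ hw1 (by omega)).trans h

/-- Passes from `|α|` to the weight `1 + |α|`: for `n ≥ 1` use `1 + n ≤ 2n`, which costs `2^θ` in
the rate; for `n = 0` the factor `e^r` compensates. -/
theorem exp_neg_rpow_le {r θ : ℝ} (hr : 0 < r) (hθ : 0 ≤ θ) (n : ℕ) :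
    Real.exp (-(2 ^ θ * r) * (n : ℝ) ^ θ) ≤ Real.exp r * Real.exp (-r * (1 + n : ℝ) ^ θ) := by
  rw [← Real.exp_add]
  gcongr
  rcases Nat.eq_zero_or_pos n with rfl | hn
  · simp only [Nat.cast_zero, add_zero, Real.one_rpow]
    have : (0 : ℝ) ≤ 2 ^ θ * r * 0 ^ θ := by positivity
    linarith
  · have hn1 : (1 : ℝ) ≤ n := by exact_mod_cast hn
    have h : (1 + n : ℝ) ^ θ ≤ 2 ^ θ * (n : ℝ) ^ θ := by
      rw [← Real.mul_rpow (by norm_num) (by positivity)]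
      gcongr
      linarith
    nlinarith [mul_le_mul_of_nonneg_left h hr.le]

theorem wongEigenvalue_le (α : MultiIdx d × MultiIdx d) :
    (wongEigenvalue α : ℝ) ≤ ((2 + d) * wongWeight α) ^ 2 := by
  have h : ∀ n : ℕ, n ≤ len α.1 + len α.2 → ((2 * n + d : ℕ) : ℝ) ≤ (2 + d) * wongWeight α := by
    intro n hn
    rw [wongWeight]
    have h1 : (n : ℝ) ≤ (len α.1 + len α.2 : ℕ) := by exact_mod_cast hn
    have h3 : (0 : ℝ) ≤ (d : ℝ) * (len α.1 + len α.2 : ℕ) := by positivity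
    push_cast at *
    nlinarith
  rw [wongEigenvalue, Nat.cast_mul, sq]
  exact mul_le_mul (h _ (Nat.le_add_left _ _)) (h _ (Nat.le_add_right _ _)) (Nat.cast_nonneg _)
    (mul_nonneg (by positivity) (zero_le_one.trans (one_le_wongWeight α)))

/-! ### Coefficient decay and the sums of `|c_α| λ_α^N`. -/

section Coefficients

variable {c : MultiIdx d × MultiIdx d → ℂ} {s ρ C : ℝ}

theorem norm_le_exp_wongWeight {r θ : ℝ} (hr : 0 < r) (hθ : 0 ≤ θ)
    (h : ∀ α, ‖c α‖ ≤ C * Real.exp (-(2 ^ θ * r) * ((len α.1 + len α.2 : ℕ) : ℝ) ^ θ))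
    (α : MultiIdx d × MultiIdx d) :
    ‖c α‖ ≤ C * Real.exp r * Real.exp (-r * wongWeight α ^ θ) := by
  have hC : 0 ≤ C := by
    have := (norm_nonneg _).trans (h α)
    exact nonneg_of_mul_nonneg_left this (Real.exp_pos _)
  refine (h α).trans ?_
  rw [mul_assoc]
  exact mul_le_mul_of_nonneg_left (exp_neg_rpow_le hr hθ _) hC

theorem rapidlyDecaying_of_norm_le_exp {q : ℝ} (hs : 0 < s) (hq : 0 < q)
    (h : ∀ α, ‖c α‖ ≤ C * Real.exp (-q * wongWeight α ^ (1 / (2 * s)))) :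
    RapidlyDecaying wongWeight c := by
  intro m
  refine ((summable_exp_mul_wongWeight_pow hs hq m).mul_left C).of_nonneg_of_le
    (fun α => mul_nonneg (norm_nonneg _)
      (pow_nonneg (zero_le_one.trans (one_le_wongWeight α)) m)) fun α => ?_
  rw [← mul_assoc]
  exact mul_le_mul_of_nonneg_right (h α) (pow_nonneg (zero_le_one.trans (one_le_wongWeight α)) m)

/-- Half of the decay rate `8sρ` cancels the exponential in the factorial bound; the other half
keeps the sum finite, with a value independent of `N`. -/
theorem exists_tsum_eigenvalue_le (hs : 0 < s) (hρ : 0 < ρ)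
    (h : ∀ α, ‖c α‖ ≤ C * Real.exp (-(8 * s * ρ) * wongWeight α ^ (1 / (2 * s)))) :
    ∃ D : ℝ, ∀ N : ℕ, ∑' α, ‖c α‖ * (wongEigenvalue α : ℝ) ^ N
      ≤ D * (((2 + d) * ρ ^ (-(2 * s))) ^ (2 * N) * (N.factorial : ℝ) ^ (4 * s)) := by
  have hsum : Summable fun α : MultiIdx d × MultiIdx d =>
      Real.exp (-(4 * s * ρ) * wongWeight α ^ (1 / (2 * s))) := by
    simpa using summable_exp_mul_wongWeight_pow (d := d) hs (by positivity : 0 < 4 * s * ρ) 0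
  refine ⟨C * ∑' α : MultiIdx d × MultiIdx d, Real.exp (-(4 * s * ρ) * wongWeight α ^ (1 / (2 * s))), fun N => ?_⟩
  have hr : Summable fun α => ‖c α‖ * (wongEigenvalue α : ℝ) ^ N := by
    simpa using ((rapidlyDecaying_of_norm_le_exp hs (by positivity) h).mul_wongEigenvalue_pow N) 0
  rw [mul_assoc, mul_comm (tsum _), ← mul_assoc, ← tsum_mul_left]
  refine hr.tsum_le_tsum (fun α => ?_) (hsum.mul_left _)
  have hw : 0 < wongWeight α := zero_lt_one.trans_le (one_le_wongWeight α)
  have hCe := (norm_nonneg _).trans (h α)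
  have h1 := pow_two_mul_le_factorial_mul_exp hs hρ hw N
  calc ‖c α‖ * (wongEigenvalue α : ℝ) ^ N
      ≤ (C * Real.exp (-(8 * s * ρ) * wongWeight α ^ (1 / (2 * s))))
          * (((2 + d) * wongWeight α) ^ 2) ^ N := by
        refine mul_le_mul (h α) ?_ (by positivity) hCe
        gcongr
        exact wongEigenvalue_le α
    _ = (C * Real.exp (-(8 * s * ρ) * wongWeight α ^ (1 / (2 * s)))) * (2 + d) ^ (2 * N)
          * wongWeight α ^ (2 * N) := by rw [← pow_mul, mul_pow]; ring
    _ ≤ (C * Real.exp (-(8 * s * ρ) * wongWeight α ^ (1 / (2 * s)))) * (2 + d) ^ (2 * N)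
          * ((ρ ^ (-(2 * s))) ^ (2 * N) * (N.factorial : ℝ) ^ (4 * s)
            * Real.exp (4 * s * ρ * wongWeight α ^ (1 / (2 * s)))) := by gcongr
    _ = C * (((2 + d) * ρ ^ (-(2 * s))) ^ (2 * N) * (N.factorial : ℝ) ^ (4 * s))
          * (Real.exp (-(8 * s * ρ) * wongWeight α ^ (1 / (2 * s)))
            * Real.exp (4 * s * ρ * wongWeight α ^ (1 / (2 * s)))) := by rw [mul_pow]; ring
    _ = _ := by rw [← Real.exp_add]; congr 2; ring

theorem rapidlyDecaying_of_finite_support (h : (Function.support c).Finite) :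
    RapidlyDecaying wongWeight c := by
  intro m
  refine summable_of_hasFiniteSupport (h.subset fun α hα => ?_)
  contrapose! hα
  simp_all

theorem exists_tsum_eigenvalue_le_of_finite_support (h : (Function.support c).Finite) :
    ∃ b : ℝ, 0 < b ∧ ∃ D : ℝ, ∀ N : ℕ,
      ∑' α, ‖c α‖ * (wongEigenvalue α : ℝ) ^ N ≤ D * b ^ (2 * N) := by
  -- Dominates every eigenvalue on the support; the summand `1` ensures `b ≤ b²`, so that also `λ_α
  -- ≤ b²`.
  set b : ℝ := 1 + ∑ α ∈ h.toFinset, (wongEigenvalue α : ℝ) with hb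
  have hb1 : 1 ≤ b := le_add_of_nonneg_right (Finset.sum_nonneg fun _ _ => Nat.cast_nonneg _)
  refine ⟨b, zero_lt_one.trans_le hb1, ∑' α, ‖c α‖, fun N => ?_⟩
  have hr := rapidlyDecaying_of_finite_support h
  rw [← tsum_mul_right]
  refine Summable.tsum_le_tsum (fun α => ?_) (by simpa using (hr.mul_wongEigenvalue_pow N) 0)
    ((by simpa using hr 0 : Summable fun α => ‖c α‖).mul_right _)
  by_cases hα : c α = 0
  · simp [hα]
  · have h1 : (wongEigenvalue α : ℝ) ≤ b := by
      have := Finset.single_le_sum (f := fun α => (wongEigenvalue α : ℝ))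
        (fun _ _ => Nat.cast_nonneg _) (h.mem_toFinset.2 hα)
      rw [hb]
      linarith
    have h2 : (wongEigenvalue α : ℝ) ≤ b ^ 2 := h1.trans (le_self_pow₀ hb1 two_ne_zero)
    rw [pow_mul]
    gcongr

end Coefficients

/-! ### From coefficient sums to the sup norm, and the conclusion. -/

theorem eLpNorm_iterate_Tσ_le {c : MultiIdx d × MultiIdx d → ℂ} {a : Phase d → ℂ}
    (ha : ∀ X, HasSum (fun α => c α * hermiteWong α X) (a X)) (hc : RapidlyDecaying wongWeight c)
    {N : ℕ} {b : ℝ} (hb : ∑' α, ‖c α‖ * (wongEigenvalue α : ℝ) ^ N ≤ b) :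
    MeasureTheory.eLpNorm (Tσ^[N] a) ⊤ MeasureTheory.volume ≤ ENNReal.ofReal b := by
  have e : a = fun X => ∑' α, c α * hermiteWong α X := funext fun X => (ha X).tsum_eq.symm
  rw [MeasureTheory.eLpNorm_exponent_top, e]
  exact MeasureTheory.eLpNormEssSup_le_of_ae_bound
    (Filter.Eventually.of_forall fun X => (norm_iterate_Tσ_tsum_le hc N X).trans hb)

theorem contDiff_of_hasSum {c : MultiIdx d × MultiIdx d → ℂ} {a : Phase d → ℂ}
    (ha : ∀ X, HasSum (fun α => c α * hermiteWong α X) (a X)) (hc : RapidlyDecaying wongWeight c) :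
    ContDiff ℝ ((⊤ : ℕ∞) : WithTop ℕ∞) a := by
  rw [show a = fun X => ∑' α, c α * hermiteWong α X from funext fun X => (ha X).tsum_eq.symm]
  exact tame_hermiteWong.contDiff_tsum hc

end TwistedPilipovic

end

theorem corollary2p6 (d : ℕ) (s : ℝ) (hs : 0 ≤ s) (a : TwistedPilipovic.Phase d → ℂ) :
    (a ∈ TwistedPilipovic.twistedRoumieu d s →
      ContDiff ℝ ((⊤ : ℕ∞) : WithTop ℕ∞) a ∧
      ∃ h : ℝ, 0 < h ∧ ∃ C : ℝ, ∀ N : ℕ,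
        MeasureTheory.eLpNorm (TwistedPilipovic.Tσ^[N] a) ⊤ MeasureTheory.volume ≤
          ENNReal.ofReal (C * (h ^ (2 * N) * (N.factorial : ℝ) ^ (4 * s)))) ∧
    (a ∈ TwistedPilipovic.twistedBeurling d s →
      ContDiff ℝ ((⊤ : ℕ∞) : WithTop ℕ∞) a ∧
      ∀ h : ℝ, 0 < h → ∃ C : ℝ, ∀ N : ℕ,
        MeasureTheory.eLpNorm (TwistedPilipovic.Tσ^[N] a) ⊤ MeasureTheory.volume ≤
          ENNReal.ofReal (C * (h ^ (2 * N) * (N.factorial : ℝ) ^ (4 * s)))) := by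
  open TwistedPilipovic in
  rcases hs.eq_or_lt with rfl | hs
  · constructor
    · rintro ⟨c, hc, ha⟩
      rw [RoumieuCoeff, if_pos rfl] at hc
      have hr := rapidlyDecaying_of_finite_support hc
      obtain ⟨b, hb, D, hD⟩ := exists_tsum_eigenvalue_le_of_finite_support hc
      refine ⟨contDiff_of_hasSum ha hr, b, hb, D, fun N => eLpNorm_iterate_Tσ_le ha hr ?_⟩
      simpa using hD N
    · rintro ⟨c, hc, ha⟩
      rw [BeurlingCoeff, if_pos rfl] at hc
      have hr : RapidlyDecaying wongWeight c := rapidlyDecaying_of_finite_support (by simp [hc])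
      refine ⟨contDiff_of_hasSum ha hr, fun h _ => ⟨0, fun N => eLpNorm_iterate_Tσ_le ha hr ?_⟩⟩
      simp [hc]
  have hθ : 0 ≤ 1 / (2 * s) := by positivity
  constructor
  · rintro ⟨c, hc, ha⟩
    rw [RoumieuCoeff, if_neg hs.ne'] at hc
    obtain ⟨r, hr, C, hC⟩ := hc
    -- Chosen so that `2^θ · 8sρ = r`, where `θ = 1/(2s)` and `2^θ` is the loss in replacing `|α|`
    -- by `1 + |α|`.
    set ρ := r / (2 ^ (1 / (2 * s)) * (8 * s)) with hρ
    have hρ0 : 0 < ρ := by positivity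
    have hb := norm_le_exp_wongWeight (c := c) (C := C) (by positivity : 0 < 8 * s * ρ) hθ (by
      convert hC using 5
      rw [hρ]
      field_simp)
    have hrd := rapidlyDecaying_of_norm_le_exp hs (by positivity) hb
    obtain ⟨D, hD⟩ := exists_tsum_eigenvalue_le hs hρ0 hb
    exact ⟨contDiff_of_hasSum ha hrd, _, by positivity, D,
      fun N => eLpNorm_iterate_Tσ_le ha hrd (hD N)⟩
  · rintro ⟨c, hc, ha⟩
    rw [BeurlingCoeff, if_neg hs.ne'] at hc
    have key : ∀ ρ : ℝ, 0 < ρ → ∃ C : ℝ, ∀ α,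
        ‖c α‖ ≤ C * Real.exp (-(8 * s * ρ) * wongWeight α ^ (1 / (2 * s))) := by
      intro ρ hρ
      obtain ⟨C, hC⟩ := hc (2 ^ (1 / (2 * s)) * (8 * s * ρ)) (by positivity)
      exact ⟨_, norm_le_exp_wongWeight (by positivity) hθ hC⟩
    have hrd : RapidlyDecaying wongWeight c := by
      -- Any single rate already gives rapid decay.
      obtain ⟨C, hC⟩ := key 1 one_pos
      exact rapidlyDecaying_of_norm_le_exp hs (by positivity) hC
    refine ⟨contDiff_of_hasSum ha hrd, fun h hh => ?_⟩
    -- The solution of `(2 + d) ρ^{-2s} = h`, so that the estimate has exactly the prescribed `h`.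
    set ρ := ((2 + d) / h) ^ (1 / (2 * s)) with hρ
    have hρ0 : 0 < ρ := by positivity
    have e : (2 + d) * ρ ^ (-(2 * s)) = h := by
      rw [hρ, ← Real.rpow_mul (by positivity),
        show 1 / (2 * s) * -(2 * s) = -1 by field_simp, Real.rpow_neg_one]
      field_simp
    obtain ⟨C, hC⟩ := key ρ hρ0
    obtain ⟨D, hD⟩ := exists_tsum_eigenvalue_le hs hρ0 hC
    rw [e] at hD
    exact ⟨D, fun N => eLpNorm_iterate_Tσ_le ha hrd (hD N)⟩
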